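/- Let $U=L^2(0,1)$, let $A=-\frac{d^2}{dx^2}$ with homogeneous Dirichlet boundary conditions on $(0,1)$, with eigenvalues $\lambda_k=k^2\pi^2$ and eigenfunctions $\phi_k(x)=\sqrt2\sin(k\pi x)$, $k\ge 1$, and let $S(t)=e^{-tA}$. For $N\in\mathbb N$ let $P_N$ be the orthogonal projection of $U$ onto $U^N=\operatorname{span}\{\phi_1,\dots,\phi_N\}$, $A_N=P_NA$ and $S_N(t)=e^{-tA_N}$ on $U^N$. Let $p\ge 2$, $\beta\in(0,\tfrac14)$ and $H\in(\tfrac12,1)$. There is a constant $C=C(p,\beta,H)>0$, depending only on $p$, $\beta$ and $H$, such that the following holds. Let $T\ge 0$ and let $(w_k^H)_{k\ge1}$ be independent standard real-valued fractional Brownian motions on $[0,T]$ with Hurst parameter $H$ on a probability space $(\Omega,\mathcal F,\mathbb P)$, i.e. centered Gaussian processes with a.s. continuous paths and covariance $\frac12\left(s^{2H}+t^{2H}-|t-s|^{2H}\right)$, and let $B^H(t)=\sum_{k\ge 1} w_k^H(t)\phi_k$ be the corresponding cylindrical fractional Brownian motion. Integrals $\int_0^t g(s)\,dB^H(s)$ of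 deterministic operator-valued $g$ are understood as $\sum_{k\ge1}\int_0^t g(s)\phi_k\,dw_k^H(s)$ with convergence of the series in $L^2(\Omega;U)$, where the integral of a $U$-valued function with respect to $w_k^H$ is the $L^2(\Omega;U)$-limit of the elementary integrals of step functions $f_n$ that approximate it in the sense that the error $h=g\phi_k-f_n$ satisfies $\int_0^t\int_0^t\|h(u)\|\,\|h(v)\|\,H(2H-1)|u-v|^{2H-2}\,du\,dv\to0$. Then for every $t\in[0,T]$ and every $N\in\mathbb N$ the stochastic convolutions $$\mathcal O_t=\int_0^t S(t-s)\,dB^H(s),\qquad \mathcal O^N_t=\int_0^t S_N(t-s)P_N\,dB^H(s)$$ exist, $\mathcal O^N_t=P_N\mathcal O_t$ almost surely, and $$\left(\mathbb E\left[\|\mathcal O_t-\mathcal O^N_t\|_{L^\infty(0,1)}^p\right]\right)^{1/p}\le C\,\lambda_{N+1}^{\beta-H+\frac14}.$$ -/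

import Mathlib

open MeasureTheory ProbabilityTheory Filter Topology
open scoped ENNReal

namespace FBmGalerkin

noncomputable section

/-- Lebesgue measure on the domain `(0, 1)`. -/
abbrev domMeasure : Measure ℝ := volume.restrict (Set.Ioo (0 : ℝ) 1)

/-- The Hilbert space `U = L²(0, 1)`. -/
abbrev U : Type := Lp ℝ 2 domMeasure

theorem memLp_sine (k : ℕ) :
    MemLp (fun x : ℝ => Real.sqrt 2 * Real.sin (k * Real.pi * x)) 2 domMeasure := by
  refine MemLp.of_bound (C := Real.sqrt 2) ?_ ?_
  · exact (by fun_prop : Continuous fun x : ℝ =>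
      Real.sqrt 2 * Real.sin (k * Real.pi * x)).aestronglyMeasurable
  · refine ae_of_all _ fun x => ?_
    rw [norm_mul, Real.norm_of_nonneg (Real.sqrt_nonneg 2), Real.norm_eq_abs]
    exact mul_le_of_le_one_right (Real.sqrt_nonneg 2) (Real.abs_sin_le_one _)

/-- The eigenfunctions `φ_k(x) = √2 sin(kπx)`, `k ≥ 1`, of the Dirichlet Laplacian on `(0, 1)`. -/
def eigenfun (k : ℕ) : U := (memLp_sine k).toLp _

/-- The eigenvalues `λ_k = k²π²`, `k ≥ 1`, of `A = -d²/dx²` with Dirichlet boundary conditions. -/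
def eigenval (k : ℕ) : ℝ := (k : ℝ) ^ 2 * Real.pi ^ 2

/-- The semigroup `S(t) = exp(-tA)` given by the spectral calculus of `A`:
`S(t) u = ∑_{k ≥ 1} e^{-λ_k t} ⟨φ_k, u⟩ φ_k`. -/
def semigroup (t : ℝ) (u : U) : U :=
  ∑' k : ℕ, (Real.exp (-eigenval (k + 1) * t) * inner ℝ (eigenfun (k + 1)) u) • eigenfun (k + 1)

/-- The Galerkin space `U^N = span {φ_1, …, φ_N}`. -/
def galerkinSpace (N : ℕ) : Submodule ℝ U :=
  Submodule.span ℝ (eigenfun '' Set.Icc 1 N)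

instance instFiniteDimensionalGalerkinSpace (N : ℕ) : FiniteDimensional ℝ (galerkinSpace N) :=
  FiniteDimensional.span_of_finite ℝ ((Set.finite_Icc 1 N).image eigenfun)

/-- The orthogonal projection `P_N` of `U` onto `U^N`. -/
def galerkinProj (N : ℕ) : U →L[ℝ] U := (galerkinSpace N).starProjection

/-- The semigroup `S_N(t) = exp(-t A_N)`, `A_N = P_N A`, on `U^N`. -/
def galerkinSemigroup (N : ℕ) (t : ℝ) (u : U) : U :=
  ∑ k ∈ Finset.Icc 1 N, (Real.exp (-eigenval k * t) * inner ℝ (eigenfun k) u) • eigenfun k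

variable {Ω : Type*} [MeasurableSpace Ω]

/-- `w` restricted to `[0, T]` is a standard fractional Brownian motion with Hurst parameter `H`:
a centered Gaussian process with almost surely continuous paths and covariance
`(s^{2H} + r^{2H} - |s - r|^{2H}) / 2`. Values outside `[0, T]` are irrelevant. -/
structure IsFBm (H T : ℝ) (w : ℝ → Ω → ℝ) (P : Measure Ω) : Prop where
  measurable : ∀ s ∈ Set.Icc 0 T, Measurable (w s)
  gaussian : IsGaussianProcess (fun s : Set.Icc (0 : ℝ) T => w s) P
  centered : ∀ s ∈ Set.Icc 0 T, ∫ ω, w s ω ∂P = 0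
  covariance_eq : ∀ s ∈ Set.Icc 0 T, ∀ r ∈ Set.Icc 0 T,
    cov[w s, w r; P] = (s ^ (2 * H) + r ^ (2 * H) - |s - r| ^ (2 * H)) / 2
  continuous_paths : ∀ᵐ ω ∂P, ContinuousOn (fun s => w s ω) (Set.Icc 0 T)

/-- The coefficients of a standard cylindrical fractional Brownian motion
`B^H(t) = ∑_{k ≥ 1} w_k(t) φ_k` on `[0, T]`: independent standard fractional Brownian motions with
the same Hurst parameter. The process `w_k`, `k ≥ 1`, of this series is `w (k - 1)` in Lean. -/
structure IsCylindricalFBm (H T : ℝ) (w : ℕ → ℝ → Ω → ℝ) (P : Measure Ω) : Prop where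
  isFBm : ∀ k, IsFBm H T (w k) P
  indep : iIndepFun (fun (k : ℕ) (ω : Ω) (s : Set.Icc (0 : ℝ) T) => w k s ω) P

/-- The kernel `H(2H - 1)|y|^{2H - 2}`. -/
def fbmKernel (H y : ℝ) : ℝ := H * (2 * H - 1) * |y| ^ (2 * H - 2)

/-- An `E`-valued step function `∑ᵢ 1_{(aᵢ, bᵢ]} cᵢ` on `[0, t]`. -/
structure StepFun (E : Type*) (t : ℝ) where
  n : ℕ
  a : Fin n → ℝ
  b : Fin n → ℝ
  c : Fin n → E
  zero_le_a : ∀ i, 0 ≤ a i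
  a_le_b : ∀ i, a i ≤ b i
  b_le : ∀ i, b i ≤ t

variable {E : Type*} [NormedAddCommGroup E] [NormedSpace ℝ E]

/-- The function represented by a step function. -/
def StepFun.eval {t : ℝ} (f : StepFun E t) (s : ℝ) : E :=
  ∑ i, (Set.Ioc (f.a i) (f.b i)).indicator (fun _ => f.c i) s

/-- The elementary integral `∑ᵢ (w(bᵢ) - w(aᵢ)) cᵢ` of a step function. -/
def StepFun.integral {t : ℝ} (f : StepFun E t) (w : ℝ → Ω → ℝ) (ω : Ω) : E :=
  ∑ i, (w (f.b i) ω - w (f.a i) ω) • f.c i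

/-- `X` is (a version of) the Wiener integral `∫₀ᵗ g(s) dw(s)` of the deterministic `E`-valued
function `g`: the limit in `L²(Ω; E)` of the elementary integrals of step functions `fₙ` with
`∫₀ᵗ ∫₀ᵗ ‖g(u) - fₙ(u)‖ ‖g(v) - fₙ(v)‖ H(2H - 1)|u - v|^{2H - 2} dv du → 0`. -/
def IsFBmIntegral (P : Measure Ω) (H t : ℝ) (w : ℝ → Ω → ℝ) (g : ℝ → E) (X : Ω → E) : Prop :=
  AEStronglyMeasurable g (volume.restrict (Set.Ioc 0 t)) ∧ MemLp X 2 P ∧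
    ∃ f : ℕ → StepFun E t,
      Tendsto (fun n => ∫⁻ u in Set.Ioc 0 t, ∫⁻ v in Set.Ioc 0 t,
        ‖g u - (f n).eval u‖ₑ * ‖g v - (f n).eval v‖ₑ * ENNReal.ofReal (fbmKernel H (u - v)))
        atTop (𝓝 0) ∧
      Tendsto (fun n => ∫⁻ ω, ‖X ω - (f n).integral w ω‖ₑ ^ 2 ∂P) atTop (𝓝 0)

/-- `X` is (a version of) the stochastic integral
`∫₀ᵗ g(s) dB^H(s) = ∑_{k ≥ 1} ∫₀ᵗ g(s) φ_k dw_k(s)`, the series converging in `L²(Ω; U)`. -/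
def IsCylindricalIntegral (P : Measure Ω) (H t : ℝ) (w : ℕ → ℝ → Ω → ℝ) (g : ℝ → U → U)
    (X : Ω → U) : Prop :=
  MemLp X 2 P ∧ ∃ Y : ℕ → Ω → U,
    (∀ k, IsFBmIntegral P H t (w k) (fun s => g s (eigenfun (k + 1))) (Y k)) ∧
    Tendsto (fun n => ∫⁻ ω, ‖X ω - ∑ k ∈ Finset.range n, Y k ω‖ₑ ^ 2 ∂P) atTop (𝓝 0)

/-- `X` is (a version of) the stochastic convolution `O_t = ∫₀ᵗ S(t - s) dB^H(s)`. -/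
def IsStochConv (P : Measure Ω) (H t : ℝ) (w : ℕ → ℝ → Ω → ℝ) (X : Ω → U) : Prop :=
  IsCylindricalIntegral P H t w (fun s ψ => semigroup (t - s) ψ) X

/-- `X` is (a version of) `O^N_t = ∫₀ᵗ S_N(t - s) P_N dB^H(s)`. -/
def IsGalerkinStochConv (P : Measure Ω) (H t : ℝ) (w : ℕ → ℝ → Ω → ℝ) (N : ℕ) (X : Ω → U) : Prop :=
  IsCylindricalIntegral P H t w (fun s ψ => galerkinSemigroup N (t - s) (galerkinProj N ψ)) X

/-- The norm of `L^∞(0, 1)`, with value `∞` outside of `L^∞(0, 1)`. -/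
def supNorm (u : U) : ℝ≥0∞ := eLpNorm u ∞ domMeasure

end

end FBmGalerkin

/-! Both convolutions diagonalize in the sine basis. The mode of index `k` of `𝒪_t` is the scalar
Wiener integral `y_k = ∫₀ᵗ e^{-λ(t-s)} dw_k(s)` with `λ = eigenval (k + 1)`, and the Galerkin
convolution keeps exactly the first `N` modes. The error is therefore the tail `∑_{k ≥ N} y_k
φ_{k+1}`, whose coefficients are independent and centered, with second moments of order `λ^{-2H}`.

The second moment of an elementary integral is a double integral against `H(2H-1)|u-v|^{2H-2}`,
bounded by the energy of the norm of the integrand (`StepFun.lintegral_integral_sq_le`). Energy is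
handled like a squared norm because this kernel is, up to a constant, the composition of
`|x|^{H-3/2}` with itself (`energy_eq_lintegral_sq`). This gives a quasi-triangle inequality, hence
existence and uniqueness of the integrals. By homogeneity of the kernel, the energy of `e^{-λ(t-u)}`
is at most `λ^{-2H}` times a constant independent of `t` (`energy_exp_le`).

For the sup norm, the tail is cut into dyadic blocks of modes between `m` and `2m`, with `m =
2^j(N+1)`. A function vanishing at `0` satisfies `|g(x)|^{2r} ≤ 2r ∫ |g|^{2r-1}|g'|`, and on a block
`g'/m` has the same size as `g`. Gaussian moments turn variances of order `m · m^{-4H}` into a bound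
of order `m^{1+(1-4H)r}` for the moment of order `2r` of the sup norm of the block
(`lintegral_blockBound_le`). Its `L^{2r}(Ω)` norm is thus of order `m^γ` with `γ = 1/(2r) + 1/2 - 2H
< 0`. Minkowski's inequality and a geometric series give `(N+1)^γ` for the tail. Since `λ_{N+1} =
((N+1)π)²`, choosing `r` with `1/(2r) ≤ 2β` yields the claimed rate; the loss `β` is the price of
the one-dimensional sup norm estimate. -/

namespace FBmGalerkin

/-! ### Riesz kernels and their composition formula -/

/-- The Riesz kernel `|x|^a` with values in `ℝ≥0∞`. -/
noncomputable def rieszKernel (a x : ℝ) : ℝ≥0∞ := ENNReal.ofReal (|x| ^ a)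

@[fun_prop]
theorem measurable_rieszKernel (a : ℝ) : Measurable (rieszKernel a) := by
  unfold rieszKernel
  fun_prop

theorem rieszKernel_neg (a x : ℝ) : rieszKernel a (-x) = rieszKernel a x := by
  simp [rieszKernel]

theorem rieszKernel_mul (a x y : ℝ) :
    rieszKernel a (x * y) = rieszKernel a x * rieszKernel a y := by
  simp only [rieszKernel, abs_mul]
  rw [Real.mul_rpow (abs_nonneg _) (abs_nonneg _), ENNReal.ofReal_mul (by positivity)]

theorem rieszKernel_le_of_le {a c x : ℝ} (ha : a ≤ 0) (hc : 0 < c) (h : c ≤ |x|) :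
    rieszKernel a x ≤ rieszKernel a c := by
  unfold rieszKernel
  rw [abs_of_pos hc]
  exact ENNReal.ofReal_le_ofReal (Real.rpow_le_rpow_of_nonpos hc h ha)

theorem lintegral_rieszKernel_Icc_lt_top {a : ℝ} (ha : -1 < a) (R : ℝ) :
    ∫⁻ x in Set.Icc (-R) R, rieszKernel a x < ∞ := by
  set g : ℝ → ℝ≥0∞ := (Set.Icc 0 R).indicator (rieszKernel a) with hg
  have hgm : Measurable g := (measurable_rieszKernel a).indicator measurableSet_Icc
  have hgfin : ∫⁻ x, g x < ∞ := by
    rw [hg, lintegral_indicator measurableSet_Icc]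
    rcases le_or_gt R 0 with hR | hR
    · have : (volume.restrict (Set.Icc 0 R) : Measure ℝ) = 0 := by
        rw [Measure.restrict_eq_zero, Real.volume_Icc]; simpa using hR
      simp [this]
    · have h1 : IntegrableOn (fun x : ℝ => x ^ a) (Set.Icc 0 R) := by
        rw [integrableOn_Icc_iff_integrableOn_Ioc]
        exact (intervalIntegrable_iff_integrableOn_Ioc_of_le hR.le).1
          (intervalIntegral.intervalIntegrable_rpow' ha)
      refine lt_of_le_of_lt (setLIntegral_mono_ae' measurableSet_Icc (ae_of_all _ ?_))
        h1.hasFiniteIntegral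
      intro x hx
      simp only [rieszKernel, abs_of_nonneg hx.1]
      exact Real.ofReal_le_enorm _
  calc ∫⁻ x in Set.Icc (-R) R, rieszKernel a x
      = ∫⁻ x, (Set.Icc (-R) R).indicator (rieszKernel a) x :=
        (lintegral_indicator measurableSet_Icc _).symm
    _ ≤ ∫⁻ x, (g x + g (-x)) := by
        refine lintegral_mono fun x => ?_
        by_cases hx : x ∈ Set.Icc (-R) R
        · rw [Set.indicator_of_mem hx]
          rcases le_total 0 x with h | h
          · refine le_add_right ?_
            rw [hg, Set.indicator_of_mem (show x ∈ Set.Icc 0 R from ⟨h, hx.2⟩)]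
          · refine le_add_left ?_
            rw [hg, Set.indicator_of_mem (show -x ∈ Set.Icc 0 R from ⟨by linarith, by linarith [hx.1]⟩),
              rieszKernel_neg]
        · rw [Set.indicator_of_notMem hx]; exact zero_le
    _ = (∫⁻ x, g x) + ∫⁻ x, g x := by
        rw [lintegral_add_left hgm, lintegral_neg_eq_self]
    _ < ∞ := ENNReal.add_lt_top.2 ⟨hgfin, hgfin⟩

theorem lintegral_comp_const_mul (f : ℝ → ℝ≥0∞) {d : ℝ} (hd : d ≠ 0) :
    ∫⁻ s, f s = ENNReal.ofReal |d| * ∫⁻ s, f (d * s) := by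
  have h := Real.smul_map_volume_mul_left hd
  conv_lhs => rw [← h]
  rw [lintegral_smul_measure, smul_eq_mul]
  congr 1
  exact (Homeomorph.mulLeft₀ d hd).measurableEmbedding.lintegral_map _

/-- The constant in the composition formula for Riesz kernels. -/
noncomputable def rieszConst (a : ℝ) : ℝ≥0∞ := ∫⁻ r, rieszKernel a r * rieszKernel a (1 - r)

/-- Both factors are at least `1` on `(0, 1)`. What matters later is that the constant is nonzero,
so that it can be cancelled. -/
theorem one_le_rieszConst {a : ℝ} (ha : a ≤ 0) : 1 ≤ rieszConst a := by
  have h1 : ∀ x : ℝ, 0 < x → x < 1 → 1 ≤ rieszKernel a x := by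
    intro x hx hx1
    unfold rieszKernel
    rw [abs_of_pos hx, ENNReal.one_le_ofReal]
    exact Real.one_le_rpow_of_pos_of_le_one_of_nonpos hx hx1.le ha
  calc (1 : ℝ≥0∞) = ∫⁻ r in Set.Ioo (0 : ℝ) 1, 1 := by simp
    _ ≤ ∫⁻ r in Set.Ioo (0 : ℝ) 1, rieszKernel a r * rieszKernel a (1 - r) := by
        refine setLIntegral_mono' measurableSet_Ioo fun x hx => ?_
        have := mul_le_mul' (h1 x hx.1 hx.2) (h1 (1 - x) (by linarith [hx.2]) (by linarith [hx.1]))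
        simpa using this
    _ ≤ _ := setLIntegral_le_lintegral _ _

/-- The singularities at `0` and `1` are integrable because `a > -1`, and the decay `|r|^{2a}` at
infinity is integrable because `2a < -1`. -/
theorem rieszConst_lt_top {a : ℝ} (ha : -1 < a) (ha' : a < -(1 / 2)) : rieszConst a < ∞ := by
  set g : ℝ → ℝ≥0∞ := (Set.Icc (-2) 2).indicator (rieszKernel a) with hg
  have hgm : Measurable g := (measurable_rieszKernel a).indicator measurableSet_Icc
  have hgfin : ∫⁻ x, g x < ∞ := by
    rw [hg, lintegral_indicator measurableSet_Icc]
    exact lintegral_rieszKernel_Icc_lt_top ha 2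
  have hbound : ∀ r : ℝ, rieszKernel a r * rieszKernel a (1 - r) ≤
      rieszKernel a (1 / 2) * (g r + g (1 - r)) +
        rieszKernel (2 * a) (1 / 3) * ENNReal.ofReal ((1 + ‖r‖) ^ (-(-(2 * a)))) := by
    intro r
    by_cases hr : r ∈ Set.Icc (-1 : ℝ) 2
    · refine le_add_right ?_
      -- On either side of `1/2` one of the two factors is evaluated at distance at least `1/2` from
      -- its singularity.
      rcases le_total r (1 / 2) with h | h
      · have e : g r = rieszKernel a r :=
          Set.indicator_of_mem (show r ∈ Set.Icc (-2 : ℝ) 2 from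
            ⟨by linarith [hr.1], by linarith⟩) _
        rw [← e, mul_comm]
        gcongr
        · exact rieszKernel_le_of_le (by linarith) (by norm_num)
            (le_trans (by linarith) (le_abs_self _))
        · exact le_self_add
      · have e : g (1 - r) = rieszKernel a (1 - r) :=
          Set.indicator_of_mem (show 1 - r ∈ Set.Icc (-2 : ℝ) 2 from
            ⟨by linarith [hr.2], by linarith⟩) _
        rw [← e]
        gcongr
        · exact rieszKernel_le_of_le (by linarith) (by norm_num)
            (le_trans (by linarith) (le_abs_self _))
        · exact le_add_self
    · refine le_add_left ?_
      have h1 : (1 / 3) * (1 + |r|) ≤ |r| ∧ (1 / 3) * (1 + |r|) ≤ |1 - r| := by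
        rcases lt_or_ge r (-1) with h | h
        · rw [abs_of_neg (by linarith), abs_of_pos (by linarith)]
          constructor <;> linarith
        · have : 2 < r := by
            by_contra hh
            exact hr ⟨h, by linarith⟩
          rw [abs_of_pos (by linarith), abs_of_neg (by linarith)]
          constructor <;> linarith
      have hpos : 0 < (1 / 3) * (1 + |r|) := by positivity
      calc rieszKernel a r * rieszKernel a (1 - r)
          ≤ rieszKernel a ((1 / 3) * (1 + |r|)) * rieszKernel a ((1 / 3) * (1 + |r|)) :=
            mul_le_mul' (rieszKernel_le_of_le (by linarith) hpos h1.1)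
              (rieszKernel_le_of_le (by linarith) hpos h1.2)
        _ = rieszKernel (2 * a) ((1 / 3) * (1 + |r|)) := by
            unfold rieszKernel
            rw [← ENNReal.ofReal_mul (by positivity), ← Real.rpow_add (abs_pos.2 hpos.ne'), two_mul]
        _ = _ := by
            rw [rieszKernel_mul, neg_neg, Real.norm_eq_abs]
            congr 1
            unfold rieszKernel
            rw [abs_of_pos (show 0 < 1 + |r| by positivity)]
  have hJ : ∫⁻ r : ℝ, ENNReal.ofReal ((1 + ‖r‖) ^ (-(-(2 * a)))) < ∞ :=
    finite_integral_one_add_norm (by simp; linarith)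
  refine lt_of_le_of_lt (lintegral_mono hbound) ?_
  rw [lintegral_add_left (by fun_prop), lintegral_const_mul _ (by fun_prop),
    lintegral_const_mul _ (by fun_prop), lintegral_add_left hgm,
    lintegral_sub_left_eq_self g (1 : ℝ)]
  refine ENNReal.add_lt_top.2 ⟨ENNReal.mul_lt_top ENNReal.ofReal_lt_top ?_,
    ENNReal.mul_lt_top ENNReal.ofReal_lt_top hJ⟩
  exact ENNReal.add_lt_top.2 ⟨hgfin, hgfin⟩

/-- The composition formula for Riesz kernels on the line. -/
theorem lintegral_rieszKernel_mul {a u v : ℝ} (huv : u ≠ v) :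
    ∫⁻ s, rieszKernel a (u - s) * rieszKernel a (v - s) =
      rieszConst a * rieszKernel (2 * a + 1) (u - v) := by
  have hd : v - u ≠ 0 := sub_ne_zero.2 huv.symm
  -- The affine map sending `0` to `u` and `1` to `v` brings the singularities to `0` and `1`;
  -- homogeneity then extracts the power of `|u - v|`.
  rw [← lintegral_add_left_eq_self _ u, lintegral_comp_const_mul _ hd]
  have e : ∀ s : ℝ, rieszKernel a (u - (u + (v - u) * s)) * rieszKernel a (v - (u + (v - u) * s))
      = rieszKernel a (v - u) * rieszKernel a (v - u) *
        (rieszKernel a s * rieszKernel a (1 - s)) := by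
    intro s
    rw [show u - (u + (v - u) * s) = -((v - u) * s) by ring, rieszKernel_neg,
      show v - (u + (v - u) * s) = (v - u) * (1 - s) by ring, rieszKernel_mul, rieszKernel_mul]
    ring
  simp_rw [e]
  rw [lintegral_const_mul _ (by fun_prop), ← mul_assoc, mul_comm, rieszConst]
  congr 1
  rw [← rieszKernel_neg _ (u - v), neg_sub u v]
  unfold rieszKernel
  have hp := abs_pos.2 hd
  rw [← ENNReal.ofReal_mul (by positivity), ← ENNReal.ofReal_mul (by positivity)]
  congr 1
  rw [two_mul, Real.rpow_add hp, Real.rpow_add hp, Real.rpow_one]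
  ring

/-! ### The energy form of the fractional kernel -/

theorem ofReal_fbmKernel {H : ℝ} (hH : 1 / 2 < H) (y : ℝ) :
    ENNReal.ofReal (fbmKernel H y) =
      ENNReal.ofReal (H * (2 * H - 1)) * rieszKernel (2 * H - 2) y := by
  unfold fbmKernel rieszKernel
  rw [ENNReal.ofReal_mul (mul_nonneg (by linarith) (by linarith))]

theorem fbmKernel_nonneg {H : ℝ} (hH : 1 / 2 < H) (y : ℝ) : 0 ≤ fbmKernel H y :=
  mul_nonneg (mul_nonneg (by linarith) (by linarith)) (Real.rpow_nonneg (abs_nonneg _) _)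

@[fun_prop]
theorem measurable_fbmKernel (H : ℝ) : Measurable (fbmKernel H) := by
  unfold fbmKernel
  fun_prop

/-- The energy `∫₀ᵗ ∫₀ᵗ F(u) F(v) H(2H - 1)|u - v|^{2H - 2} dv du` of a nonnegative function. -/
noncomputable def energy (H t : ℝ) (F : ℝ → ℝ≥0∞) : ℝ≥0∞ :=
  ∫⁻ u in Set.Ioc 0 t, ∫⁻ v in Set.Ioc 0 t, F u * F v * ENNReal.ofReal (fbmKernel H (u - v))

theorem energy_mono_ae {H t : ℝ} {F G : ℝ → ℝ≥0∞} (h : ∀ᵐ u ∂volume.restrict (Set.Ioc 0 t), F u ≤ G u) :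
    energy H t F ≤ energy H t G := by
  refine lintegral_mono_ae ?_
  filter_upwards [h] with u hu
  refine lintegral_mono_ae ?_
  filter_upwards [h] with v hv
  gcongr

theorem energy_mono {H t : ℝ} {F G : ℝ → ℝ≥0∞} (h : ∀ u ∈ Set.Ioc 0 t, F u ≤ G u) :
    energy H t F ≤ energy H t G :=
  energy_mono_ae ((ae_restrict_iff' measurableSet_Ioc).2 (ae_of_all _ h))

/-- The energy as a weighted sum of squares. -/
theorem energy_eq_lintegral_sq {H t : ℝ} (hH : H ∈ Set.Ioo (1 / 2 : ℝ) 1) {F : ℝ → ℝ≥0∞}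
    (hF : AEMeasurable F (volume.restrict (Set.Ioc 0 t))) :
    energy H t F = ENNReal.ofReal (H * (2 * H - 1)) * (rieszConst (H - 3 / 2))⁻¹ *
      ∫⁻ s, (∫⁻ u in Set.Ioc 0 t, F u * rieszKernel (H - 3 / 2) (u - s)) ^ 2 := by
  obtain ⟨hH1, hH2⟩ := hH
  set μ : Measure ℝ := volume.restrict (Set.Ioc 0 t)
  set a := H - 3 / 2 with ha
  have hc0 : rieszConst a ≠ 0 := (zero_lt_one.trans_le (one_le_rieszConst (by linarith))).ne'
  have hct : rieszConst a ≠ ∞ := (rieszConst_lt_top (by linarith) (by linarith)).ne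
  have hsq : ∀ s, (∫⁻ u, F u * rieszKernel a (u - s) ∂μ) ^ 2 =
      ∫⁻ u, ∫⁻ v, F u * F v * (rieszKernel a (u - s) * rieszKernel a (v - s)) ∂μ ∂μ := by
    intro s
    have hm : AEMeasurable (fun u => F u * rieszKernel a (u - s)) μ := hF.mul (by fun_prop)
    rw [sq, ← lintegral_lintegral_mul hm hm]
    congr! 4 with u v
    ring
  simp_rw [hsq]
  have hFu : ∀ s : ℝ, AEMeasurable (fun z : ℝ × ℝ => F z.1 * F z.2 *
      (rieszKernel a (z.1 - s) * rieszKernel a (z.2 - s))) (μ.prod μ) := fun s =>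
    (hF.comp_fst.mul hF.comp_snd).mul (by fun_prop)
  -- Tonelli: the expanded square is integrated in `s` first, which produces the composition of the
  -- two Riesz kernels.
  have h1 : ∫⁻ s, ∫⁻ u, ∫⁻ v, F u * F v * (rieszKernel a (u - s) * rieszKernel a (v - s)) ∂μ ∂μ
      = ∫⁻ z, ∫⁻ s, F z.1 * F z.2 * (rieszKernel a (z.1 - s) * rieszKernel a (z.2 - s)) ∂volume
        ∂(μ.prod μ) := by
    rw [← lintegral_lintegral_swap (f := fun (s : ℝ) (z : ℝ × ℝ) => F z.1 * F z.2 *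
      (rieszKernel a (z.1 - s) * rieszKernel a (z.2 - s)))]
    · exact lintegral_congr fun s => lintegral_lintegral
        (f := fun u v => F u * F v * (rieszKernel a (u - s) * rieszKernel a (v - s))) (hFu s)
    · have hp : AEMeasurable (fun z : ℝ × ℝ => F z.1 * F z.2) (μ.prod μ) :=
        hF.comp_fst.mul hF.comp_snd
      have hq : Measurable (fun z : ℝ × ℝ × ℝ =>
          rieszKernel a (z.2.1 - z.1) * rieszKernel a (z.2.2 - z.1)) := by fun_prop
      exact (hp.comp_snd (μ := (volume : Measure ℝ))).mul hq.aemeasurable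
  have h2 : ∀ᵐ z ∂(μ.prod μ), ∫⁻ s, F z.1 * F z.2 *
      (rieszKernel a (z.1 - s) * rieszKernel a (z.2 - s)) =
      rieszConst a * (F z.1 * F z.2 * rieszKernel (2 * H - 2) (z.1 - z.2)) := by
    -- The composition formula requires distinct points; the diagonal is a null set.
    have hne : ∀ᵐ z ∂(μ.prod μ), z.1 ≠ z.2 := by
      have hm : MeasurableSet {z : ℝ × ℝ | z.1 ≠ z.2} :=
        (measurableSet_eq_fun measurable_fst measurable_snd).compl
      rw [Measure.ae_prod_iff_ae_ae hm]
      refine ae_of_all _ fun x => ?_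
      have : ∀ᵐ y ∂μ, y ≠ x := by simp [ae_iff]
      filter_upwards [this] with y hy using hy.symm
    filter_upwards [hne] with z hz
    rw [lintegral_const_mul _ (by fun_prop), lintegral_rieszKernel_mul hz,
      show 2 * a + 1 = 2 * H - 2 by rw [ha]; ring]
    ring
  have hm3 : AEMeasurable (fun z : ℝ × ℝ => F z.1 * F z.2 * rieszKernel (2 * H - 2) (z.1 - z.2))
      (μ.prod μ) := (hF.comp_fst.mul hF.comp_snd).mul (by fun_prop)
  rw [h1, lintegral_congr_ae h2, lintegral_const_mul'' _ hm3]
  unfold energy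
  simp_rw [ofReal_fbmKernel hH1]
  have hm4 : AEMeasurable (fun z : ℝ × ℝ => F z.1 * F z.2 *
      (ENNReal.ofReal (H * (2 * H - 1)) * rieszKernel (2 * H - 2) (z.1 - z.2)))
      (μ.prod μ) := (hF.comp_fst.mul hF.comp_snd).mul (by fun_prop)
  rw [lintegral_lintegral hm4]
  simp_rw [mul_left_comm _ (ENNReal.ofReal (H * (2 * H - 1)))]
  rw [lintegral_const_mul'' _ hm3, mul_assoc, ← mul_assoc _ (rieszConst a),
    ENNReal.inv_mul_cancel hc0 hct, one_mul]

theorem add_sq_le_two_mul_add (a b : ℝ≥0∞) : (a + b) ^ 2 ≤ 2 * a ^ 2 + 2 * b ^ 2 := by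
  have h := ENNReal.rpow_add_le_mul_rpow_add_rpow a b (p := 2) (by norm_num)
  norm_num at h
  rw [← mul_add]
  exact_mod_cast h

/-- The cross terms `F(u)G(v)` have no useful pointwise bound against the kernel. In the
sum-of-squares form the inequality reduces to `(a + b)² ≤ 2a² + 2b²` for each `s`. -/
theorem energy_add_le {H t : ℝ} (hH : H ∈ Set.Ioo (1 / 2 : ℝ) 1) {F G : ℝ → ℝ≥0∞}
    (hF : AEMeasurable F (volume.restrict (Set.Ioc 0 t)))
    (hG : AEMeasurable G (volume.restrict (Set.Ioc 0 t))) :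
    energy H t (fun u => F u + G u) ≤ 2 * energy H t F + 2 * energy H t G := by
  rw [energy_eq_lintegral_sq hH hF, energy_eq_lintegral_sq hH hG,
    energy_eq_lintegral_sq (F := fun u => F u + G u) hH (hF.add hG), mul_left_comm 2, mul_left_comm 2, ← mul_add]
  gcongr
  set μ : Measure ℝ := volume.restrict (Set.Ioc 0 t)
  have hm : ∀ {K : ℝ → ℝ≥0∞}, AEMeasurable K μ → AEMeasurable
      (fun s : ℝ => (∫⁻ u, K u * rieszKernel (H - 3 / 2) (u - s) ∂μ) ^ 2) volume := by
    intro K hK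
    refine AEMeasurable.pow_const ?_ 2
    refine AEMeasurable.lintegral_prod_right' (f := fun z : ℝ × ℝ => K z.2 * rieszKernel (H - 3 / 2) (z.2 - z.1)) ?_
    exact hK.comp_snd.mul (by fun_prop)
  rw [← lintegral_const_mul'' _ (hm hF), ← lintegral_const_mul'' _ (hm hG),
    ← lintegral_add_left' ((hm hF).const_mul _)]
  refine lintegral_mono fun s => ?_
  refine le_trans (le_of_eq ?_) (add_sq_le_two_mul_add _ _)
  have hm' : AEMeasurable (fun u => F u * rieszKernel (H - 3 / 2) (u - s)) μ :=
    hF.mul (by fun_prop)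
  simp_rw [add_mul]
  rw [lintegral_add_left' hm']

/-! ### The energy of exponentials and of constants -/

theorem lintegral_exp_neg_Ici : ∫⁻ x in Set.Ici (0 : ℝ), ENNReal.ofReal (Real.exp (-x)) = 1 := by
  rw [setLIntegral_congr Ioi_ae_eq_Ici.symm, ← ofReal_integral_eq_lintegral_ofReal
    (integrableOn_exp_neg_Ioi 0) (ae_of_all _ fun x => (Real.exp_pos _).le), integral_exp_neg_Ioi_zero]
  simp

/-- The function `x ↦ e^{-x}` on `[0, ∞)`. -/
noncomputable def expTail (x : ℝ) : ℝ≥0∞ :=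
  (Set.Ici (0 : ℝ)).indicator (fun x => ENNReal.ofReal (Real.exp (-x))) x

@[fun_prop]
theorem measurable_expTail : Measurable expTail :=
  Measurable.indicator (by fun_prop) measurableSet_Ici

theorem expTail_le_one (x : ℝ) : expTail x ≤ 1 := by
  unfold expTail
  refine Set.indicator_apply_le' (fun hx => ?_) (fun _ => zero_le)
  rw [ENNReal.ofReal_le_one, Real.exp_le_one_iff]
  simpa using hx

theorem lintegral_expTail : ∫⁻ x, expTail x = 1 := by
  unfold expTail
  rw [lintegral_indicator measurableSet_Ici, lintegral_exp_neg_Ici]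

/-- The energy of the exponential on the half-line. -/
noncomputable def expEnergy (H : ℝ) : ℝ≥0∞ :=
  ∫⁻ x, ∫⁻ y, expTail x * expTail y * ENNReal.ofReal (fbmKernel H (x - y))

/-- The inner integral is bounded uniformly in `x`: within distance `1` of the diagonal the kernel
is integrable and `expTail ≤ 1`, while farther away the power `|x - y|^{2H-2}` is at most `1` and
`expTail` is integrable. -/
theorem expEnergy_lt_top {H : ℝ} (hH : H ∈ Set.Ioo (1 / 2 : ℝ) 1) : expEnergy H < ∞ := by
  obtain ⟨h1, h2⟩ := hH
  set c := ENNReal.ofReal (H * (2 * H - 1))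
  set I := ∫⁻ x in Set.Icc (-1) 1, rieszKernel (2 * H - 2) x
  have hI : I < ∞ := lintegral_rieszKernel_Icc_lt_top (by linarith) 1
  have hin : ∀ x, ∫⁻ y, expTail y * ENNReal.ofReal (fbmKernel H (x - y)) ≤ c * (1 + I) := by
    intro x
    simp_rw [ofReal_fbmKernel h1, mul_left_comm _ (ENNReal.ofReal (H * (2 * H - 1)))]
    have hm : Measurable fun y => expTail y * rieszKernel (2 * H - 2) (x - y) := by fun_prop
    rw [lintegral_const_mul _ hm]
    gcongr
    have hp : ∀ y, expTail y * rieszKernel (2 * H - 2) (x - y) ≤ expTail y +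
        (Set.Icc (-1 : ℝ) 1).indicator (rieszKernel (2 * H - 2)) (x - y) := by
      intro y
      by_cases hy : x - y ∈ Set.Icc (-1 : ℝ) 1
      · rw [Set.indicator_of_mem hy]
        refine le_add_left ?_
        calc _ ≤ 1 * rieszKernel (2 * H - 2) (x - y) := by gcongr; exact expTail_le_one y
          _ = _ := one_mul _
      · rw [Set.indicator_of_notMem hy, add_zero]
        calc _ ≤ expTail y * 1 := by
              gcongr
              refine (rieszKernel_le_of_le (by linarith) one_pos ?_).trans (by simp [rieszKernel])
              by_contra h
              exact hy (abs_le.1 (not_le.1 h).le)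
          _ = _ := mul_one _
    refine (lintegral_mono hp).trans ?_
    rw [lintegral_add_left (by fun_prop), lintegral_expTail, lintegral_sub_left_eq_self,
      lintegral_indicator measurableSet_Icc]
  have : expEnergy H ≤ c * (1 + I) := by
    calc expEnergy H = ∫⁻ x, expTail x * ∫⁻ y, expTail y * ENNReal.ofReal (fbmKernel H (x - y)) := by
          unfold expEnergy
          refine lintegral_congr fun x => ?_
          rw [← lintegral_const_mul _ (by fun_prop)]
          simp_rw [mul_assoc]
      _ ≤ ∫⁻ x, expTail x * (c * (1 + I)) := by
          gcongr with x
          exact hin x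
      _ = _ := by rw [lintegral_mul_const _ (by fun_prop), lintegral_expTail, one_mul]
  refine this.trans_lt (ENNReal.mul_lt_top ENNReal.ofReal_lt_top ?_)
  exact ENNReal.add_lt_top.2 ⟨ENNReal.one_lt_top, hI⟩

/-- After reversing time, the domain is enlarged to the half-line, which removes the dependence on
`t`. Rescaling by `λ` gives `λ^{-1} · λ^{-1}` from the two variables and `λ^{2-2H}` from the kernel.
-/
theorem energy_exp_le {H t lam : ℝ} (hH : 1 / 2 < H) (hl : 0 < lam) :
    energy H t (fun u => ENNReal.ofReal (Real.exp (-lam * (t - u)))) ≤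
      ENNReal.ofReal (lam ^ (-(2 * H))) * expEnergy H := by
  set k : ℝ → ℝ≥0∞ := fun y => ENNReal.ofReal (fbmKernel H y) with hk
  have hkm : Measurable k := by fun_prop
  set G : ℝ → ℝ≥0∞ := fun x => expTail (lam * x) with hG
  have hGm : Measurable G := by fun_prop
  have hle : ∀ u ∈ Set.Ioc 0 t, ENNReal.ofReal (Real.exp (-lam * (t - u))) = G (t - u) := by
    intro u hu
    rw [hG]
    simp only [expTail]
    rw [Set.indicator_of_mem, neg_mul]
    exact mul_nonneg hl.le (by linarith [hu.2])
  have hkey : ∫⁻ x, ∫⁻ y, G x * G y * k (x - y) = ENNReal.ofReal (lam ^ (-(2 * H))) * expEnergy H := by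
    have hsc : ∀ y, k (lam⁻¹ * y) = ENNReal.ofReal (lam ^ (2 - 2 * H)) * k y := by
      intro y
      simp only [hk, ofReal_fbmKernel hH, rieszKernel_mul]
      have : rieszKernel (2 * H - 2) lam⁻¹ = ENNReal.ofReal (lam ^ (2 - 2 * H)) := by
        unfold rieszKernel
        rw [abs_of_pos (by positivity), Real.inv_rpow hl.le, ← Real.rpow_neg hl.le, neg_sub]
      rw [this]
      ring
    have hl' : lam⁻¹ ≠ 0 := by positivity
    rw [lintegral_comp_const_mul _ hl']
    have : ∀ x, ∫⁻ y, G (lam⁻¹ * x) * G y * k (lam⁻¹ * x - y) =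
        ENNReal.ofReal lam⁻¹ * (ENNReal.ofReal (lam ^ (2 - 2 * H)) *
          ∫⁻ y, expTail x * expTail y * k (x - y)) := by
      intro x
      rw [lintegral_comp_const_mul _ hl', abs_of_pos (by positivity)]
      congr 1
      have hm : Measurable fun y => expTail x * expTail y * k (x - y) := by fun_prop
      rw [← lintegral_const_mul _ hm]
      refine lintegral_congr fun y => ?_
      rw [← mul_sub, hsc, hG]
      simp only [mul_inv_cancel_left₀ hl.ne']
      ring
    simp_rw [this]
    have hm : Measurable fun x => ∫⁻ y, expTail x * expTail y * k (x - y) :=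
      Measurable.lintegral_prod_right' (f := fun z : ℝ × ℝ => expTail z.1 * expTail z.2 * k (z.1 - z.2))
        (by fun_prop)
    rw [lintegral_const_mul _ (hm.const_mul _), lintegral_const_mul _ hm, ← mul_assoc, ← mul_assoc,
      abs_of_pos (by positivity), expEnergy]
    congr 1
    rw [← ENNReal.ofReal_mul (by positivity), ← ENNReal.ofReal_mul (by positivity)]
    congr 1
    rw [← Real.rpow_neg_one, ← Real.rpow_add hl, ← Real.rpow_add hl]
    congr 1
    ring
  rw [← hkey]
  calc energy H t (fun u => ENNReal.ofReal (Real.exp (-lam * (t - u))))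
      ≤ energy H t (fun u => G (t - u)) := energy_mono fun u hu => (hle u hu).le
    _ ≤ ∫⁻ u, ∫⁻ v, G (t - u) * G (t - v) * k (u - v) := by
        refine (setLIntegral_le_lintegral _ _).trans (lintegral_mono fun u => ?_)
        exact setLIntegral_le_lintegral _ _
    _ = ∫⁻ x, ∫⁻ y, G x * G y * k (x - y) := by
        rw [← lintegral_sub_left_eq_self (fun x => ∫⁻ y, G x * G y * k (x - y)) t]
        refine lintegral_congr fun u => ?_
        rw [← lintegral_sub_left_eq_self (fun y => G (t - u) * G y * k (t - u - y)) t]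
        refine lintegral_congr fun v => ?_
        rw [show t - u - (t - v) = -(u - v) by ring]
        simp [hk, fbmKernel, abs_sub_comm]

theorem energy_const_mul {H t : ℝ} {c : ℝ≥0∞} (hc : c ≠ ∞) (F : ℝ → ℝ≥0∞) :
    energy H t (fun u => c * F u) = c ^ 2 * energy H t F := by
  unfold energy
  rw [← lintegral_const_mul' _ _ (ENNReal.pow_ne_top hc)]
  refine lintegral_congr fun u => ?_
  rw [← lintegral_const_mul' _ _ (ENNReal.pow_ne_top hc)]
  refine lintegral_congr fun v => ?_
  ring

/-- Constants have finite energy. -/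
theorem energy_one_lt_top {H : ℝ} (hH : H ∈ Set.Ioo (1 / 2 : ℝ) 1) (t : ℝ) :
    energy H t (fun _ => 1) < ∞ := by
  calc energy H t (fun _ => 1)
      ≤ energy H t (fun u => ENNReal.ofReal (Real.exp t) *
          ENNReal.ofReal (Real.exp (-1 * (t - u)))) := by
        -- Since `u ≥ 0`, the constant `1` is at most `e^t e^{-(t-u)}`, which reduces to the
        -- exponential with `λ = 1`.
        refine energy_mono fun u hu => ?_
        rw [← ENNReal.ofReal_mul (Real.exp_pos _).le, ← Real.exp_add, ENNReal.one_le_ofReal,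
          Real.one_le_exp_iff]
        linarith [hu.1]
    _ = ENNReal.ofReal (Real.exp t) ^ 2 *
          energy H t (fun u => ENNReal.ofReal (Real.exp (-1 * (t - u)))) :=
        energy_const_mul ENNReal.ofReal_ne_top _
    _ ≤ ENNReal.ofReal (Real.exp t) ^ 2 * (ENNReal.ofReal (1 ^ (-(2 * H))) * expEnergy H) := by
        gcongr
        exact energy_exp_le hH.1 one_pos
    _ < ∞ := ENNReal.mul_lt_top (ENNReal.pow_lt_top ENNReal.ofReal_lt_top)
        (ENNReal.mul_lt_top ENNReal.ofReal_lt_top (expEnergy_lt_top hH))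

/-! ### The increment covariance as a double integral of the kernel -/

theorem hasDerivAt_abs_rpow_mul_self {r x : ℝ} (hx : x ≠ 0) :
    HasDerivAt (fun x : ℝ => |x| ^ r * x) ((r + 1) * |x| ^ r) x := by
  have h1 : HasDerivAt (fun x : ℝ => |x| ^ r) (SignType.sign x * r * |x| ^ (r - 1)) x := by
    have := (hasDerivAt_abs hx).rpow_const (p := r) (Or.inl (abs_pos.2 hx).ne')
    exact this
  have h2 := h1.mul (hasDerivAt_id x)
  refine h2.congr_deriv ?_
  have h3 : |x| ^ r = |x| ^ (r - 1) * |x| := by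
    rw [← Real.rpow_add_one (abs_pos.2 hx).ne']; congr 1; ring
  have h4 : (SignType.sign x : ℝ) * x = |x| := sign_mul_self x
  simp only [id]
  rw [mul_one, h3]
  linear_combination (r * |x| ^ (r - 1)) * h4

/-- Up to the factor `p` this is the derivative of the `C¹` function `|x|^p`. For `p = 2H` it gives
continuity at the origin, where the exponent `p - 2` is negative. -/
theorem continuous_abs_rpow_mul_self {p : ℝ} (hp : 1 < p) :
    Continuous fun x : ℝ => |x| ^ (p - 2) * x := by
  have h : Continuous (deriv fun x : ℝ => |x| ^ p) :=
    (contDiff_norm_rpow (E := ℝ) hp).continuous_deriv le_rfl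
  have e : (deriv fun x : ℝ => |x| ^ p) = fun x => p * (|x| ^ (p - 2) * x) := by
    funext x
    rw [(hasDerivAt_abs_rpow x hp).deriv, mul_assoc]
  rw [e] at h
  have h' := h.const_mul p⁻¹
  simpa [inv_mul_cancel_left₀ (show p ≠ 0 by linarith)] using h'

theorem intervalIntegrable_fbmKernel_sub {H : ℝ} (hH : 1 / 2 < H) (u c d : ℝ) :
    IntervalIntegrable (fun v => fbmKernel H (u - v)) volume c d := by
  have h : ∀ c d : ℝ, IntegrableOn (fun v => fbmKernel H (u - v)) (Set.Ioc c d) := by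
    intro c d
    refine ⟨(by fun_prop : Measurable fun v => fbmKernel H (u - v)).aestronglyMeasurable, ?_⟩
    set R := |u| + |c| + |d|
    have hle : ∀ v ∈ Set.Ioc c d, ‖fbmKernel H (u - v)‖ₑ ≤ ENNReal.ofReal (H * (2 * H - 1)) *
        (Set.Icc (-R) R).indicator (rieszKernel (2 * H - 2)) (u - v) := by
      intro v hv
      rw [Real.enorm_of_nonneg (fbmKernel_nonneg hH _), ofReal_fbmKernel hH, Set.indicator_of_mem]
      have h1 := neg_abs_le c
      have h2 := le_abs_self d
      have h3 := le_abs_self u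
      have h4 := neg_abs_le u
      have h5 := abs_nonneg c
      have h6 := abs_nonneg d
      constructor <;> simp only [R] <;> linarith [hv.1, hv.2]
    refine (setLIntegral_mono' measurableSet_Ioc hle).trans_lt ?_
    refine (setLIntegral_le_lintegral _ _).trans_lt ?_
    rw [lintegral_sub_left_eq_self (fun x => ENNReal.ofReal (H * (2 * H - 1)) *
      (Set.Icc (-R) R).indicator (rieszKernel (2 * H - 2)) x), lintegral_const_mul',
      lintegral_indicator measurableSet_Icc]
    · exact ENNReal.mul_lt_top ENNReal.ofReal_lt_top
        (lintegral_rieszKernel_Icc_lt_top (by linarith) R)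
    · exact ENNReal.ofReal_ne_top
  exact ⟨h c d, h d c⟩

/-- The primitive is continuous everywhere and differentiable except at `v = u`, so the fundamental
theorem of calculus off a countable set applies despite the singularity. -/
theorem integral_fbmKernel_sub {H : ℝ} (hH : 1 / 2 < H) (u c d : ℝ) :
    ∫ v in c..d, fbmKernel H (u - v) =
      H * (|u - c| ^ (2 * H - 2) * (u - c)) - H * (|u - d| ^ (2 * H - 2) * (u - d)) := by
  have h := integral_eq_of_hasDerivAt_off_countable
    (fun v => -(H * (|u - v| ^ (2 * H - 2) * (u - v)))) (fun v => fbmKernel H (u - v))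
    (a := c) (b := d) (Set.countable_singleton u) ?_ ?_
    (intervalIntegrable_fbmKernel_sub hH u c d)
  · rw [h]; ring
  · have := (continuous_abs_rpow_mul_self (p := 2 * H) (by linarith)).comp (continuous_const.sub continuous_id : Continuous fun v : ℝ => u - v)
    exact ((this.const_mul H).neg).continuousOn
  · intro v hv
    have hne : u - v ≠ 0 := sub_ne_zero.2 fun h => hv.2 h.symm
    have h1 := (hasDerivAt_abs_rpow_mul_self (r := 2 * H - 2) hne).comp v
      ((hasDerivAt_id v).const_sub u)
    refine ((h1.const_mul H).neg).congr_deriv ?_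
    unfold fbmKernel
    ring

/-- The inner integral is again a derivative, since `H|x|^{2H-2}x` is that of `|x|^{2H}/2`. The
outcome is the covariance of the increments of fractional Brownian motion over `(a, b]` and `(c,
d]`. -/
theorem integral_integral_fbmKernel_sub {H : ℝ} (hH : 1 / 2 < H) (a b c d : ℝ) :
    ∫ u in a..b, ∫ v in c..d, fbmKernel H (u - v) =
      (|b - c| ^ (2 * H) - |a - c| ^ (2 * H) - |b - d| ^ (2 * H) + |a - d| ^ (2 * H)) / 2 := by
  simp_rw [integral_fbmKernel_sub hH]
  have hcont := continuous_abs_rpow_mul_self (p := 2 * H) (by linarith)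
  have h := intervalIntegral.integral_eq_sub_of_hasDerivAt (a := a) (b := b)
    (f := fun u => (|u - c| ^ (2 * H) - |u - d| ^ (2 * H)) / 2)
    (f' := fun u => H * (|u - c| ^ (2 * H - 2) * (u - c)) - H * (|u - d| ^ (2 * H - 2) * (u - d)))
    ?_ ?_
  · rw [h]; ring
  · intro u _
    have h1 := (hasDerivAt_abs_rpow (u - c) (p := 2 * H) (by linarith)).comp u ((hasDerivAt_id u).sub_const c)
    have h2 := (hasDerivAt_abs_rpow (u - d) (p := 2 * H) (by linarith)).comp u ((hasDerivAt_id u).sub_const d)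
    refine ((h1.sub h2).div_const 2).congr_deriv ?_
    ring
  · refine Continuous.intervalIntegrable ?_ _ _
    have h1 := hcont.comp (continuous_id.sub continuous_const : Continuous fun v : ℝ => v - c)
    have h2 := hcont.comp (continuous_id.sub continuous_const : Continuous fun v : ℝ => v - d)
    exact (h1.const_mul H).sub (h2.const_mul H)

theorem integrable_fbmKernel_prod {H : ℝ} (hH : H ∈ Set.Ioo (1 / 2 : ℝ) 1) (t : ℝ) :
    Integrable (fun z : ℝ × ℝ => fbmKernel H (z.1 - z.2))
      ((volume.restrict (Set.Ioc 0 t)).prod (volume.restrict (Set.Ioc 0 t))) := by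
  refine ⟨(by fun_prop : Measurable fun z : ℝ × ℝ =>
    fbmKernel H (z.1 - z.2)).aestronglyMeasurable, ?_⟩
  unfold HasFiniteIntegral
  rw [lintegral_prod _ (by fun_prop)]
  refine lt_of_le_of_lt (le_of_eq ?_) (energy_one_lt_top hH t)
  unfold energy
  simp_rw [Real.enorm_of_nonneg (fbmKernel_nonneg hH.1 _), one_mul]

theorem integral_indicator_mul_fbmKernel {H t : ℝ} (hH : H ∈ Set.Ioo (1 / 2 : ℝ) 1)
    {a b c d : ℝ} (ha : 0 ≤ a) (hab : a ≤ b) (hb : b ≤ t) (hc : 0 ≤ c) (hcd : c ≤ d) (hd : d ≤ t) :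
    ∫ z, (Set.Ioc a b ×ˢ Set.Ioc c d).indicator (fun z : ℝ × ℝ => fbmKernel H (z.1 - z.2)) z
      ∂((volume.restrict (Set.Ioc 0 t)).prod (volume.restrict (Set.Ioc 0 t))) =
      (|b - c| ^ (2 * H) - |a - c| ^ (2 * H) - |b - d| ^ (2 * H) + |a - d| ^ (2 * H)) / 2 := by
  rw [integral_indicator (measurableSet_Ioc.prod measurableSet_Ioc), ← Measure.prod_restrict,
    Measure.restrict_restrict measurableSet_Ioc, Measure.restrict_restrict measurableSet_Ioc,
    Set.inter_eq_left.2 (Set.Ioc_subset_Ioc ha hb), Set.inter_eq_left.2 (Set.Ioc_subset_Ioc hc hd),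
    integral_prod, ← integral_integral_fbmKernel_sub hH.1, intervalIntegral.integral_of_le hab]
  · simp_rw [intervalIntegral.integral_of_le hcd]
  · exact (integrable_fbmKernel_prod hH t).mono_measure
      (Measure.prod_mono (Measure.restrict_mono (Set.Ioc_subset_Ioc ha hb) le_rfl)
        (Measure.restrict_mono (Set.Ioc_subset_Ioc hc hd) le_rfl))

/-! ### Elementary integrals and their second moments -/

section FBm

variable {Ω : Type*} [MeasurableSpace Ω] {P : Measure Ω} {H T t : ℝ} {w : ℝ → Ω → ℝ}

theorem IsFBm.memLp_two (hw : IsFBm H T w P) {s : ℝ} (hs : s ∈ Set.Icc 0 T) : MemLp (w s) 2 P :=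
  (hw.gaussian.hasGaussianLaw_eval ⟨s, hs⟩).memLp_two

theorem IsFBm.integral_mul (hw : IsFBm H T w P) {s r : ℝ} (hs : s ∈ Set.Icc 0 T)
    (hr : r ∈ Set.Icc 0 T) :
    ∫ ω, w s ω * w r ω ∂P = (s ^ (2 * H) + r ^ (2 * H) - |s - r| ^ (2 * H)) / 2 := by
  have : IsProbabilityMeasure P := hw.gaussian.isProbabilityMeasure
  rw [← hw.covariance_eq s hs r hr, covariance_eq_sub (hw.memLp_two hs) (hw.memLp_two hr),
    hw.centered s hs]
  simp

theorem IsFBm.integral_increment_mul (hw : IsFBm H T w P) {a b c d : ℝ}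
    (ha : a ∈ Set.Icc 0 T) (hb : b ∈ Set.Icc 0 T) (hc : c ∈ Set.Icc 0 T) (hd : d ∈ Set.Icc 0 T) :
    ∫ ω, (w b ω - w a ω) * (w d ω - w c ω) ∂P =
      (|b - c| ^ (2 * H) - |a - c| ^ (2 * H) - |b - d| ^ (2 * H) + |a - d| ^ (2 * H)) / 2 := by
  have hi : ∀ {s r}, s ∈ Set.Icc 0 T → r ∈ Set.Icc 0 T → Integrable (fun ω => w s ω * w r ω) P :=
    fun hs hr => (hw.memLp_two hs).integrable_mul (hw.memLp_two hr)
  have e : ∀ ω, (w b ω - w a ω) * (w d ω - w c ω) =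
      w b ω * w d ω - w b ω * w c ω - (w a ω * w d ω - w a ω * w c ω) := fun ω => by ring
  have h1 : Integrable (fun ω => w b ω * w d ω - w b ω * w c ω) P := (hi hb hd).sub (hi hb hc)
  have h2 : Integrable (fun ω => w a ω * w d ω - w a ω * w c ω) P := (hi ha hd).sub (hi ha hc)
  simp_rw [e]
  rw [integral_sub h1 h2, integral_sub (hi hb hd) (hi hb hc), integral_sub (hi ha hd) (hi ha hc),
    hw.integral_mul hb hd, hw.integral_mul hb hc, hw.integral_mul ha hd, hw.integral_mul ha hc]
  ring

theorem StepFun.a_mem {E : Type*} (f : StepFun E t) (ht : t ≤ T) (i : Fin f.n) :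
    f.a i ∈ Set.Icc 0 T :=
  ⟨f.zero_le_a i, (f.a_le_b i).trans ((f.b_le i).trans ht)⟩

theorem StepFun.b_mem {E : Type*} (f : StepFun E t) (ht : t ≤ T) (i : Fin f.n) :
    f.b i ∈ Set.Icc 0 T :=
  ⟨(f.zero_le_a i).trans (f.a_le_b i), (f.b_le i).trans ht⟩

section Normed

variable {E : Type*} [NormedAddCommGroup E] [NormedSpace ℝ E]

theorem StepFun.memLp_integral (hw : IsFBm H T w P) (ht : t ≤ T) (f : StepFun E t) :
    MemLp (f.integral w) 2 P := by
  unfold StepFun.integral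
  refine memLp_finsetSum _ fun i _ => ?_
  have h := (hw.memLp_two (f.b_mem ht i)).sub (hw.memLp_two (f.a_mem ht i))
  exact (ContinuousLinearMap.toSpanSingleton ℝ (f.c i)).comp_memLp' h

omit [NormedSpace ℝ E] in
theorem StepFun.stronglyMeasurable_eval (f : StepFun E t) : StronglyMeasurable f.eval := by
  unfold StepFun.eval
  refine Finset.stronglyMeasurable_fun_sum _ fun i _ => ?_
  exact stronglyMeasurable_const.indicator measurableSet_Ioc

/-- The difference of two step functions. -/
def StepFun.sub (f g : StepFun E t) : StepFun E t where
  n := f.n + g.n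
  a := Fin.append f.a g.a
  b := Fin.append f.b g.b
  c := Fin.append f.c fun i => -g.c i
  zero_le_a i := by
    refine Fin.addCases (fun i => ?_) (fun i => ?_) i <;> simp [f.zero_le_a, g.zero_le_a]
  a_le_b i := by
    refine Fin.addCases (fun i => ?_) (fun i => ?_) i <;> simp [f.a_le_b, g.a_le_b]
  b_le i := by
    refine Fin.addCases (fun i => ?_) (fun i => ?_) i <;> simp [f.b_le, g.b_le]

omit [NormedSpace ℝ E] in
theorem StepFun.eval_sub (f g : StepFun E t) (s : ℝ) :
    (f.sub g).eval s = f.eval s - g.eval s := by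
  unfold StepFun.eval
  change ∑ i : Fin (f.n + g.n), _ = _
  rw [Fin.sum_univ_add]
  simp only [StepFun.sub, Fin.append_left, Fin.append_right, sub_eq_add_neg,
    ← Finset.sum_neg_distrib]
  congr 1
  refine Finset.sum_congr rfl fun i _ => ?_
  by_cases h : s ∈ Set.Ioc (g.a i) (g.b i) <;> simp [h]

omit [MeasurableSpace Ω] in
theorem StepFun.integral_sub (f g : StepFun E t) (w : ℝ → Ω → ℝ) (ω : Ω) :
    (f.sub g).integral w ω = f.integral w ω - g.integral w ω := by
  unfold StepFun.integral
  change ∑ i : Fin (f.n + g.n), _ = _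
  rw [Fin.sum_univ_add]
  simp only [StepFun.sub, Fin.append_left, Fin.append_right, sub_eq_add_neg,
    ← Finset.sum_neg_distrib, smul_neg]

/-- The image of a step function under a linear map. -/
def StepFun.map {F : Type*} [NormedAddCommGroup F] [NormedSpace ℝ F] (L : E →ₗ[ℝ] F)
    (f : StepFun E t) : StepFun F t where
  n := f.n
  a := f.a
  b := f.b
  c i := L (f.c i)
  zero_le_a := f.zero_le_a
  a_le_b := f.a_le_b
  b_le := f.b_le

theorem StepFun.eval_map {F : Type*} [NormedAddCommGroup F] [NormedSpace ℝ F] (L : E →ₗ[ℝ] F)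
    (f : StepFun E t) (s : ℝ) : (f.map L).eval s = L (f.eval s) := by
  simp only [StepFun.eval, StepFun.map, map_sum]
  refine Finset.sum_congr rfl fun i _ => ?_
  by_cases h : s ∈ Set.Ioc (f.a i) (f.b i) <;> simp [h]

omit [MeasurableSpace Ω] in
theorem StepFun.integral_map {F : Type*} [NormedAddCommGroup F] [NormedSpace ℝ F] (L : E →ₗ[ℝ] F)
    (f : StepFun E t) (w : ℝ → Ω → ℝ) (ω : Ω) :
    (f.map L).integral w ω = L (f.integral w ω) := by
  simp only [StepFun.integral, StepFun.map, map_sum, map_smul]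
  rfl

end Normed

theorem lintegral_enorm_sq {F : Type*} [NormedAddCommGroup F] {X : Ω → F}
    (hX : MemLp X 2 P) : ∫⁻ ω, ‖X ω‖ₑ ^ 2 ∂P = ENNReal.ofReal (∫ ω, ‖X ω‖ ^ 2 ∂P) := by
  rw [ofReal_integral_eq_lintegral_ofReal hX.norm.integrable_sq (ae_of_all _ fun _ => by positivity)]
  refine lintegral_congr fun ω => ?_
  rw [ENNReal.ofReal_pow (norm_nonneg _), ofReal_norm]

/-- The second moment of an elementary integral is at most the energy of the integrand. -/
theorem StepFun.lintegral_integral_sq_le {E : Type*} [NormedAddCommGroup E] [InnerProductSpace ℝ E]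
    (hH : H ∈ Set.Ioo (1 / 2 : ℝ) 1) (hw : IsFBm H T w P) (ht : t ≤ T) (f : StepFun E t) :
    ∫⁻ ω, ‖f.integral w ω‖ₑ ^ 2 ∂P ≤ energy H t (fun u => ‖f.eval u‖ₑ) := by
  set μ : Measure ℝ := volume.restrict (Set.Ioc 0 t)
  rw [lintegral_enorm_sq (f.memLp_integral hw ht)]
  -- Expanding the square, each covariance of increments is the integral of the kernel over the
  -- corresponding rectangle.
  have h1 : ∫ ω, ‖f.integral w ω‖ ^ 2 ∂P = ∑ i, ∑ j, inner ℝ (f.c i) (f.c j) *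
      ∫ z, (Set.Ioc (f.a i) (f.b i) ×ˢ Set.Ioc (f.a j) (f.b j)).indicator
        (fun z : ℝ × ℝ => fbmKernel H (z.1 - z.2)) z ∂(μ.prod μ) := by
    have e : ∀ ω, ‖f.integral w ω‖ ^ 2 = ∑ i, ∑ j, inner ℝ (f.c i) (f.c j) *
        ((w (f.b i) ω - w (f.a i) ω) * (w (f.b j) ω - w (f.a j) ω)) := by
      intro ω
      rw [← real_inner_self_eq_norm_sq, StepFun.integral, sum_inner]
      refine Finset.sum_congr rfl fun i _ => ?_
      rw [inner_sum]
      refine Finset.sum_congr rfl fun j _ => ?_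
      rw [real_inner_smul_left, real_inner_smul_right]
      ring
    have hi : ∀ i j, Integrable (fun ω => inner ℝ (f.c i) (f.c j) *
        ((w (f.b i) ω - w (f.a i) ω) * (w (f.b j) ω - w (f.a j) ω))) P := by
      intro i j
      refine Integrable.const_mul ?_ _
      exact ((hw.memLp_two (f.b_mem ht i)).sub (hw.memLp_two (f.a_mem ht i))).integrable_mul
        ((hw.memLp_two (f.b_mem ht j)).sub (hw.memLp_two (f.a_mem ht j)))
    simp_rw [e]
    rw [integral_finsetSum _ fun i _ => integrable_finsetSum _ fun j _ => hi i j]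
    refine Finset.sum_congr rfl fun i _ => ?_
    rw [integral_finsetSum _ fun j _ => hi i j]
    refine Finset.sum_congr rfl fun j _ => ?_
    rw [integral_const_mul, hw.integral_increment_mul (f.a_mem ht i) (f.b_mem ht i)
      (f.a_mem ht j) (f.b_mem ht j), integral_indicator_mul_fbmKernel hH (f.zero_le_a i)
      (f.a_le_b i) (f.b_le i) (f.zero_le_a j) (f.a_le_b j) (f.b_le j)]
  -- Resummation gives the exact isometry. Only afterwards is the inner product replaced by the
  -- product of norms, which turns equality into the energy bound.
  have h2 : ∫ ω, ‖f.integral w ω‖ ^ 2 ∂P =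
      ∫ z, inner ℝ (f.eval z.1) (f.eval z.2) * fbmKernel H (z.1 - z.2) ∂(μ.prod μ) := by
    have hi : ∀ i j, Integrable (fun z : ℝ × ℝ => inner ℝ (f.c i) (f.c j) *
        (Set.Ioc (f.a i) (f.b i) ×ˢ Set.Ioc (f.a j) (f.b j)).indicator
          (fun z : ℝ × ℝ => fbmKernel H (z.1 - z.2)) z) (μ.prod μ) := fun i j =>
      ((integrable_fbmKernel_prod hH t).indicator
        (measurableSet_Ioc.prod measurableSet_Ioc)).const_mul _
    rw [h1]
    simp_rw [← integral_const_mul]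
    simp_rw [← integral_finsetSum _ fun j (_ : j ∈ Finset.univ) => hi _ j]
    rw [← integral_finsetSum _ fun i _ => integrable_finsetSum _ fun j _ => hi i j]
    refine integral_congr_ae (ae_of_all _ fun z => ?_)
    simp only [StepFun.eval, sum_inner, inner_sum, Finset.sum_mul]
    rw [Finset.sum_comm]
    refine Finset.sum_congr rfl fun j _ => Finset.sum_congr rfl fun i _ => ?_
    by_cases hz1 : z.1 ∈ Set.Ioc (f.a i) (f.b i)
    · by_cases hz2 : z.2 ∈ Set.Ioc (f.a j) (f.b j)
      · rw [Set.indicator_of_mem (Set.mk_mem_prod hz1 hz2), Set.indicator_of_mem hz1,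
          Set.indicator_of_mem hz2]
      · rw [Set.indicator_of_notMem (fun h => hz2 h.2), Set.indicator_of_notMem hz2]
        simp
    · rw [Set.indicator_of_notMem (fun h => hz1 h.1), Set.indicator_of_notMem hz1]
      simp
  rw [h2]
  refine (Real.ofReal_le_enorm _).trans ((enorm_integral_le_lintegral_enorm _).trans ?_)
  have hm : Measurable fun u => ‖f.eval u‖ₑ :=
    StronglyMeasurable.enorm f.stronglyMeasurable_eval
  unfold energy
  rw [lintegral_lintegral]
  · refine lintegral_mono fun z => ?_
    rw [enorm_mul, Real.enorm_of_nonneg (fbmKernel_nonneg hH.1 _)]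
    gcongr
    simp only [← ofReal_norm]
    rw [← ENNReal.ofReal_mul (norm_nonneg _)]
    exact ENNReal.ofReal_le_ofReal (norm_inner_le_norm _ _)
  · exact (((hm.comp measurable_fst).mul (hm.comp measurable_snd)).mul (by fun_prop)).aemeasurable

end FBm

/-! ### Mean square convergence -/

section MeanSquare

variable {Ω F : Type*} [MeasurableSpace Ω] {P : Measure Ω} [NormedAddCommGroup F]

theorem enorm_sub_sq_le (a b c : F) : ‖a - c‖ₑ ^ 2 ≤ 2 * ‖a - b‖ₑ ^ 2 + 2 * ‖b - c‖ₑ ^ 2 := by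
  refine le_trans ?_ (add_sq_le_two_mul_add _ _)
  gcongr
  rw [← sub_add_sub_cancel a b c]
  exact enorm_add_le _ _

theorem lintegral_enorm_sub_sq_le {X Y Z : Ω → F} (hX : AEStronglyMeasurable X P)
    (hY : AEStronglyMeasurable Y P) (hZ : AEStronglyMeasurable Z P) :
    ∫⁻ ω, ‖X ω - Z ω‖ₑ ^ 2 ∂P ≤
      2 * ∫⁻ ω, ‖X ω - Y ω‖ₑ ^ 2 ∂P + 2 * ∫⁻ ω, ‖Y ω - Z ω‖ₑ ^ 2 ∂P := by
  have h1 : AEMeasurable (fun ω => ‖X ω - Y ω‖ₑ ^ 2) P := (hX.sub hY).enorm.pow_const 2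
  have h2 : AEMeasurable (fun ω => ‖Y ω - Z ω‖ₑ ^ 2) P := (hY.sub hZ).enorm.pow_const 2
  rw [← lintegral_const_mul'' _ h1, ← lintegral_const_mul'' _ h2,
    ← lintegral_add_left' (h1.const_mul _)]
  exact lintegral_mono fun ω => enorm_sub_sq_le _ _ _

theorem lintegral_enorm_sub_sq_comm (X Y : Ω → F) :
    ∫⁻ ω, ‖X ω - Y ω‖ₑ ^ 2 ∂P = ∫⁻ ω, ‖Y ω - X ω‖ₑ ^ 2 ∂P := by
  simp_rw [enorm_sub_rev (X _) (Y _)]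

theorem ae_eq_of_lintegral_enorm_sub_sq_eq_zero {X Y : Ω → F} (hX : AEStronglyMeasurable X P)
    (hY : AEStronglyMeasurable Y P) (h : ∫⁻ ω, ‖X ω - Y ω‖ₑ ^ 2 ∂P = 0) : X =ᵐ[P] Y := by
  have hm : AEMeasurable (fun ω => ‖X ω - Y ω‖ₑ ^ 2) P := (hX.sub hY).enorm.pow_const 2
  rw [lintegral_eq_zero_iff' hm] at h
  filter_upwards [h] with ω hω
  have : ‖X ω - Y ω‖ₑ = 0 := by simpa using hω
  exact sub_eq_zero.1 (enorm_eq_zero.1 this)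

/-- Mean square limits are unique. -/
theorem ae_eq_of_tendsto_lintegral_enorm_sub_sq {X Y : Ω → F} {S : ℕ → Ω → F}
    (hX : AEStronglyMeasurable X P) (hY : AEStronglyMeasurable Y P)
    (hS : ∀ n, AEStronglyMeasurable (S n) P)
    (h1 : Tendsto (fun n => ∫⁻ ω, ‖X ω - S n ω‖ₑ ^ 2 ∂P) atTop (𝓝 0))
    (h2 : Tendsto (fun n => ∫⁻ ω, ‖Y ω - S n ω‖ₑ ^ 2 ∂P) atTop (𝓝 0)) : X =ᵐ[P] Y := by
  refine ae_eq_of_lintegral_enorm_sub_sq_eq_zero hX hY (le_antisymm ?_ zero_le)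
  have h := (ENNReal.Tendsto.const_mul h1 (Or.inr (ENNReal.ofNat_ne_top (n := 2)))).add
    (ENNReal.Tendsto.const_mul h2 (Or.inr (ENNReal.ofNat_ne_top (n := 2))))
  simp only [mul_zero, add_zero] at h
  refine ge_of_tendsto' h fun n => ?_
  rw [lintegral_enorm_sub_sq_comm Y]
  exact lintegral_enorm_sub_sq_le hX (hS n) hY

theorem eLpNorm_two_sq (X : Ω → F) : eLpNorm X 2 P ^ 2 = ∫⁻ ω, ‖X ω‖ₑ ^ 2 ∂P := by
  have := eLpNorm_nnreal_pow_eq_lintegral (f := X) (μ := P) (p := 2) two_ne_zero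
  simp only [NNReal.coe_ofNat, ENNReal.rpow_ofNat] at this
  exact_mod_cast this

/-- Mean square completeness. -/
theorem exists_tendsto_lintegral_enorm_sub_sq [CompleteSpace F] {S : ℕ → Ω → F}
    (hS : ∀ n, MemLp (S n) 2 P) {e : ℕ → ℝ≥0∞} (he : Tendsto e atTop (𝓝 0))
    (h : ∀ n m, ∫⁻ ω, ‖S n ω - S m ω‖ₑ ^ 2 ∂P ≤ e n + e m) :
    ∃ X : Ω → F, MemLp X 2 P ∧ Tendsto (fun n => ∫⁻ ω, ‖X ω - S n ω‖ₑ ^ 2 ∂P) atTop (𝓝 0) := by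
  have hd : ∀ n m, edist ((hS n).toLp) ((hS m).toLp) ^ 2 ≤ e n + e m := by
    intro n m
    rw [Lp.edist_toLp_toLp, eLpNorm_two_sq]
    exact h n m
  have hc : CauchySeq fun n => (hS n).toLp := by
    rw [EMetric.cauchySeq_iff]
    intro ε hε
    have hε2 : 0 < ε ^ 2 / 2 := ENNReal.div_pos (ENNReal.pow_pos hε 2).ne' (by norm_num)
    obtain ⟨N, hN⟩ := eventually_atTop.1 (he.eventually (gt_mem_nhds hε2))
    refine ⟨N, fun m hm n hn => ?_⟩
    refine lt_of_pow_lt_pow_left' 2 ?_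
    refine (hd m n).trans_lt ((ENNReal.add_lt_add (hN m hm) (hN n hn)).trans_le ?_)
    rw [ENNReal.add_halves]
  obtain ⟨X, hX⟩ := cauchySeq_tendsto_of_complete hc
  refine ⟨X, Lp.memLp X, ?_⟩
  have h2 : Tendsto (fun n => edist X (hS n).toLp ^ 2) atTop (𝓝 0) := by
    have := ENNReal.Tendsto.pow (n := 2) (tendsto_iff_edist_tendsto_0.1 hX)
    simpa [edist_comm] using this
  refine h2.congr fun n => ?_
  rw [Lp.edist_def, eLpNorm_two_sq]
  refine lintegral_congr_ae ?_
  filter_upwards [(hS n).coeFn_toLp] with ω hω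
  simp [hω]

/-- A mean square convergent sequence has an almost surely convergent subsequence. -/
theorem exists_seq_tendsto_ae_of_tendsto_lintegral_enorm_sub_sq {X : Ω → F} {S : ℕ → Ω → F}
    (hX : AEStronglyMeasurable X P) (hS : ∀ n, AEStronglyMeasurable (S n) P)
    (h : Tendsto (fun n => ∫⁻ ω, ‖X ω - S n ω‖ₑ ^ 2 ∂P) atTop (𝓝 0)) :
    ∃ ns : ℕ → ℕ, StrictMono ns ∧ ∀ᵐ ω ∂P, Tendsto (fun i => S (ns i) ω) atTop (𝓝 (X ω)) := by
  have h1 : Tendsto (fun n => eLpNorm (S n - X) 2 P) atTop (𝓝 0) := by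
    have h2 := h.ennrpow_const (1 / 2 : ℝ)
    rw [ENNReal.zero_rpow_of_pos (by norm_num)] at h2
    refine h2.congr fun n => ?_
    have := eLpNorm_two_sq (P := P) (S n - X)
    simp only [Pi.sub_apply] at this
    rw [lintegral_enorm_sub_sq_comm, ← this, ← ENNReal.rpow_natCast, ← ENNReal.rpow_mul]
    norm_num
  exact (tendstoInMeasure_of_tendsto_eLpNorm two_ne_zero hS hX h1).exists_seq_tendsto_ae

end MeanSquare

/-! ### Wiener integrals and the integrals of exponentials -/

section Integral

variable {Ω : Type*} [MeasurableSpace Ω] {P : Measure Ω} {H T t : ℝ} {w : ℝ → Ω → ℝ}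
  {E : Type*} [NormedAddCommGroup E] [InnerProductSpace ℝ E]

/-- Inserting `g` between the two step functions gives the one estimate behind both facts about the
integral: approximating sequences have Cauchy integrals, and two such sequences have the same limit.
-/
theorem StepFun.lintegral_integral_sub_sq_le (hH : H ∈ Set.Ioo (1 / 2 : ℝ) 1) (hw : IsFBm H T w P)
    (ht : t ≤ T) {g : ℝ → E} (hg : AEStronglyMeasurable g (volume.restrict (Set.Ioc 0 t)))
    (f f' : StepFun E t) :
    ∫⁻ ω, ‖f.integral w ω - f'.integral w ω‖ₑ ^ 2 ∂P ≤
      2 * energy H t (fun u => ‖g u - f.eval u‖ₑ) + 2 * energy H t (fun u => ‖g u - f'.eval u‖ₑ) := by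
  have hm : ∀ f : StepFun E t, AEMeasurable (fun u => ‖g u - f.eval u‖ₑ)
      (volume.restrict (Set.Ioc 0 t)) := fun f =>
    (hg.sub f.stronglyMeasurable_eval.aestronglyMeasurable).enorm
  calc ∫⁻ ω, ‖f.integral w ω - f'.integral w ω‖ₑ ^ 2 ∂P
      = ∫⁻ ω, ‖(f.sub f').integral w ω‖ₑ ^ 2 ∂P := by simp_rw [StepFun.integral_sub]
    _ ≤ energy H t (fun u => ‖(f.sub f').eval u‖ₑ) :=
        StepFun.lintegral_integral_sq_le hH hw ht _
    _ ≤ energy H t (fun u => ‖g u - f.eval u‖ₑ + ‖g u - f'.eval u‖ₑ) := by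
        refine energy_mono fun u _ => ?_
        rw [StepFun.eval_sub, enorm_sub_rev (g u) (f.eval u), ← sub_add_sub_cancel _ (g u)]
        exact enorm_add_le _ _
    _ ≤ _ := energy_add_le hH (hm _) (hm _)

/-- The Wiener integral is unique up to modification. -/
theorem IsFBmIntegral.ae_eq (hH : H ∈ Set.Ioo (1 / 2 : ℝ) 1) (hw : IsFBm H T w P) (ht : t ≤ T)
    {g : ℝ → E} {X Y : Ω → E} (hX : IsFBmIntegral P H t w g X) (hY : IsFBmIntegral P H t w g Y) :
    X =ᵐ[P] Y := by
  obtain ⟨hg, hX, f, hf, hfX⟩ := hX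
  obtain ⟨-, hY, f', hf', hfY⟩ := hY
  have hI : ∀ f : StepFun E t, AEStronglyMeasurable (f.integral w) P := fun f =>
    (f.memLp_integral hw ht).aestronglyMeasurable
  have htwo : (2 : ℝ≥0∞) ≠ ∞ := ENNReal.ofNat_ne_top
  have hlim : Tendsto (fun n => 2 * energy H t (fun u => ‖g u - (f n).eval u‖ₑ) +
      2 * energy H t (fun u => ‖g u - (f' n).eval u‖ₑ)) atTop (𝓝 0) := by
    have := (ENNReal.Tendsto.const_mul hf (Or.inr htwo)).add
      (ENNReal.Tendsto.const_mul hf' (Or.inr htwo))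
    simp only [mul_zero, add_zero] at this
    exact this
  have hdiff : Tendsto (fun n => ∫⁻ ω, ‖(f n).integral w ω - (f' n).integral w ω‖ₑ ^ 2 ∂P)
      atTop (𝓝 0) := by
    refine tendsto_of_tendsto_of_tendsto_of_le_of_le tendsto_const_nhds hlim (fun _ => zero_le)
      fun n => ?_
    exact StepFun.lintegral_integral_sub_sq_le hH hw ht hg _ _
  have hY' : Tendsto (fun n => ∫⁻ ω, ‖Y ω - (f n).integral w ω‖ₑ ^ 2 ∂P) atTop (𝓝 0) := by
    have := (ENNReal.Tendsto.const_mul hfY (Or.inr htwo)).add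
      (ENNReal.Tendsto.const_mul hdiff (Or.inr htwo))
    simp only [mul_zero, add_zero] at this
    refine tendsto_of_tendsto_of_tendsto_of_le_of_le tendsto_const_nhds this (fun _ => zero_le)
      fun n => ?_
    simp only
    rw [lintegral_enorm_sub_sq_comm ((f n).integral w)]
    exact lintegral_enorm_sub_sq_le hY.aestronglyMeasurable (hI _) (hI _)
  exact ae_eq_of_tendsto_lintegral_enorm_sub_sq hX.aestronglyMeasurable hY.aestronglyMeasurable
    (fun n => hI _) hfX hY'

/-- The left-endpoint approximation of `s ↦ e^{-λ(t - s)}` on `[0, t]` by a step function. -/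
noncomputable def expStep (lam : ℝ) (ht : 0 ≤ t) (n : ℕ) : StepFun ℝ t where
  n := n + 1
  a i := t * i / (n + 1)
  b i := t * (i + 1) / (n + 1)
  c i := Real.exp (-lam * (t - t * i / (n + 1)))
  zero_le_a i := by positivity
  a_le_b i := by gcongr; linarith
  b_le i := by
    have : ((i : ℕ) : ℝ) + 1 ≤ n + 1 := by exact_mod_cast i.2
    rw [div_le_iff₀ (by positivity)]
    gcongr

theorem exists_eval_expStep (lam : ℝ) (ht : 0 ≤ t) (n : ℕ) {s : ℝ} (hs : s ∈ Set.Ioc 0 t) :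
    ∃ a, a ≤ s ∧ s - a ≤ t / (n + 1) ∧
      (expStep lam ht n).eval s = Real.exp (-lam * (t - a)) := by
  have htpos : 0 < t := hs.1.trans_le hs.2
  have hn : (0 : ℝ) < n + 1 := by positivity
  -- The cells are open on the left and closed on the right, so the cell containing `s` is found by
  -- a ceiling, lowered by one.
  obtain ⟨m, hm⟩ : ∃ m, ⌈s * (n + 1) / t⌉₊ = m + 1 :=
    Nat.exists_eq_succ_of_ne_zero (Nat.ceil_pos.2 (by have := hs.1; positivity)).ne'
  have h1 : s * (n + 1) / t ≤ m + 1 := by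
    have := Nat.le_ceil (s * (n + 1) / t)
    rw [hm] at this
    exact_mod_cast this
  have h2 : (m : ℝ) < s * (n + 1) / t := Nat.lt_ceil.1 (by omega)
  have hmn : m < n + 1 := by
    have h3 : s * (n + 1) / t ≤ n + 1 := by
      rw [div_le_iff₀ htpos, mul_comm]
      gcongr
      exact hs.2
    exact_mod_cast h2.trans_le h3
  rw [div_le_iff₀ htpos] at h1
  rw [lt_div_iff₀ htpos] at h2
  have key : ∀ i : ℕ, s ∈ Set.Ioc (t * i / (n + 1)) (t * (i + 1) / (n + 1)) ↔ i = m := by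
    intro i
    rw [Set.mem_Ioc, div_lt_iff₀ hn, le_div_iff₀ hn]
    constructor
    · rintro ⟨h3, h4⟩
      have h5 : (i : ℝ) < m + 1 := lt_of_mul_lt_mul_left (h3.trans_le (h1.trans_eq (mul_comm _ _))) htpos.le
      have h6 : (m : ℝ) < i + 1 := lt_of_mul_lt_mul_left ((mul_comm t (m : ℝ)).trans_lt (h2.trans_le h4)) htpos.le
      norm_cast at h5 h6
      omega
    · rintro rfl
      exact ⟨by linarith, by linarith⟩
  refine ⟨t * m / (n + 1), ((key m).2 rfl).1.le, ?_, ?_⟩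
  · have := ((key m).2 rfl).2
    have e : t * (m + 1) / (n + 1) = t * m / (n + 1) + t / (n + 1) := by ring
    linarith
  · unfold StepFun.eval
    change ∑ i : Fin (n + 1), _ = _
    rw [Finset.sum_eq_single (⟨m, hmn⟩ : Fin (n + 1))]
    · exact Set.indicator_of_mem ((key m).2 rfl) _
    · intro i _ hi
      refine Set.indicator_of_notMem (fun h => hi ?_) _
      exact Fin.ext ((key i).1 h)
    · simp

/-- The integrand increases in `s`, so its left-endpoint approximation stays below it. Hence the
second moment bound holds for every approximation, without loss. -/
theorem eval_expStep_le {lam : ℝ} (hl : 0 ≤ lam) (ht : 0 ≤ t) (n : ℕ) {s : ℝ}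
    (hs : s ∈ Set.Ioc 0 t) :
    ‖(expStep lam ht n).eval s‖ₑ ≤ ENNReal.ofReal (Real.exp (-lam * (t - s))) := by
  obtain ⟨a, has, -, e⟩ := exists_eval_expStep lam ht n hs
  rw [e, Real.enorm_of_nonneg (Real.exp_pos _).le]
  refine ENNReal.ofReal_le_ofReal (Real.exp_le_exp.2 ?_)
  nlinarith

theorem sub_eval_expStep_le {lam : ℝ} (hl : 0 ≤ lam) (ht : 0 ≤ t) (n : ℕ) {s : ℝ}
    (hs : s ∈ Set.Ioc 0 t) :
    ‖Real.exp (-lam * (t - s)) - (expStep lam ht n).eval s‖ₑ ≤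
      ENNReal.ofReal (lam * (t / (n + 1))) := by
  obtain ⟨a, has, hsa, e⟩ := exists_eval_expStep lam ht n hs
  have h1 : Real.exp (-lam * (t - a)) = Real.exp (-lam * (t - s)) * Real.exp (-(lam * (s - a))) := by
    rw [← Real.exp_add]; congr 1; ring
  have h2 : 1 - lam * (s - a) ≤ Real.exp (-(lam * (s - a))) := by
    have := Real.add_one_le_exp (-(lam * (s - a)))
    linarith
  have h3 : Real.exp (-lam * (t - s)) ≤ 1 :=
    Real.exp_le_one_iff.2 (by nlinarith [hs.2])
  have h4 : Real.exp (-(lam * (s - a))) ≤ 1 :=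
    Real.exp_le_one_iff.2 (by nlinarith)
  have h5 := Real.exp_pos (-lam * (t - s))
  rw [e, h1, Real.enorm_of_nonneg (by nlinarith)]
  refine ENNReal.ofReal_le_ofReal ?_
  have h6 : lam * (s - a) ≤ lam * (t / (n + 1)) := by gcongr
  have h7 : 0 ≤ lam * (s - a) := mul_nonneg hl (by linarith)
  nlinarith

/-- The error is uniformly at most `λt/(n+1)`, and constants have finite energy. -/
theorem tendsto_energy_sub_expStep (hH : H ∈ Set.Ioo (1 / 2 : ℝ) 1) {lam : ℝ} (hl : 0 ≤ lam)
    (ht : 0 ≤ t) : Tendsto (fun n => energy H t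
      (fun u => ‖Real.exp (-lam * (t - u)) - (expStep lam ht n).eval u‖ₑ)) atTop (𝓝 0) := by
  have h1 : Tendsto (fun n : ℕ => ENNReal.ofReal (lam * (t / (n + 1))) ^ 2 *
      energy H t (fun _ => 1)) atTop (𝓝 0) := by
    have h2 : Tendsto (fun n : ℕ => lam * (t / ((n : ℝ) + 1))) atTop (𝓝 0) := by
      have := (tendsto_one_div_add_atTop_nhds_zero_nat (𝕜 := ℝ)).const_mul (lam * t)
      rw [mul_zero] at this
      exact this.congr fun n => by ring
    have h3 := ENNReal.Tendsto.pow (n := 2) (ENNReal.tendsto_ofReal h2)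
    have h4 := ENNReal.Tendsto.mul_const h3 (b := energy H t (fun _ => 1))
      (Or.inr (energy_one_lt_top hH t).ne)
    simpa using h4
  refine tendsto_of_tendsto_of_tendsto_of_le_of_le tendsto_const_nhds h1 (fun _ => zero_le)
    fun n => ?_
  simp only
  rw [← energy_const_mul ENNReal.ofReal_ne_top]
  refine energy_mono fun u hu => ?_
  rw [mul_one]
  exact sub_eval_expStep_le hl ht n hu

theorem lintegral_integral_expStep_sq_le (hH : H ∈ Set.Ioo (1 / 2 : ℝ) 1) (hw : IsFBm H T w P)
    (ht : 0 ≤ t) (htT : t ≤ T) {lam : ℝ} (hl : 0 < lam) (n : ℕ) :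
    ∫⁻ ω, ‖(expStep lam ht n).integral w ω‖ₑ ^ 2 ∂P ≤
      ENNReal.ofReal (lam ^ (-(2 * H))) * expEnergy H := by
  refine (StepFun.lintegral_integral_sq_le hH hw htT _).trans ?_
  refine (energy_mono fun u hu => ?_).trans (energy_exp_le hH.1 hl)
  exact eval_expStep_le hl.le ht n hu

/-- Existence of the scalar integral `∫₀ᵗ e^{-λ(t - s)} dw(s)`. -/
theorem exists_integral_exp (hH : H ∈ Set.Ioo (1 / 2 : ℝ) 1) (hw : IsFBm H T w P)
    (ht : 0 ≤ t) (htT : t ≤ T) {lam : ℝ} (hl : 0 < lam) :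
    ∃ y : Ω → ℝ, MemLp y 2 P ∧
      Tendsto (fun n => ∫⁻ ω, ‖y ω - (expStep lam ht n).integral w ω‖ₑ ^ 2 ∂P) atTop (𝓝 0) := by
  have htwo : (2 : ℝ≥0∞) ≠ ∞ := ENNReal.ofNat_ne_top
  have hlim := ENNReal.Tendsto.const_mul (tendsto_energy_sub_expStep hH hl.le ht) (Or.inr htwo)
  rw [mul_zero] at hlim
  refine exists_tendsto_lintegral_enorm_sub_sq (fun n => StepFun.memLp_integral hw htT _) hlim ?_
  exact fun n m => StepFun.lintegral_integral_sub_sq_le hH hw htT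
    (by fun_prop : Measurable fun u => Real.exp (-lam * (t - u))).aestronglyMeasurable _ _

/-- The integral of `s ↦ e^{-λ(t - s)} e` is the scalar integral times `e`. -/
theorem isFBmIntegral_exp_smul (hH : H ∈ Set.Ioo (1 / 2 : ℝ) 1)
    (ht : 0 ≤ t) {lam : ℝ} (hl : 0 < lam) {y : Ω → ℝ} (hy : MemLp y 2 P)
    (hlim : Tendsto (fun n => ∫⁻ ω, ‖y ω - (expStep lam ht n).integral w ω‖ₑ ^ 2 ∂P) atTop (𝓝 0))
    (e : E) :
    IsFBmIntegral P H t w (fun s => Real.exp (-lam * (t - s)) • e) (fun ω => y ω • e) := by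
  set L : ℝ →L[ℝ] E := ContinuousLinearMap.toSpanSingleton ℝ e
  have hL : ∀ x : ℝ, L x = x • e := fun x => ContinuousLinearMap.toSpanSingleton_apply ℝ e x
  refine ⟨?_, ?_, fun n => (expStep lam ht n).map L.toLinearMap, ?_, ?_⟩
  · exact (by fun_prop : Continuous fun s => Real.exp (-lam * (t - s)) • e).aestronglyMeasurable
  · exact L.comp_memLp' hy
  · have h := ENNReal.Tendsto.const_mul (a := ‖e‖ₑ ^ 2) (tendsto_energy_sub_expStep hH hl.le ht)
      (Or.inr (ENNReal.pow_ne_top enorm_ne_top))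
    rw [mul_zero] at h
    refine h.congr fun n => ?_
    rw [← energy_const_mul enorm_ne_top]
    simp_rw [StepFun.eval_map]
    unfold energy
    congr! 7 with u v
    all_goals
      rw [ContinuousLinearMap.coe_coe, hL, ← sub_smul, enorm_smul, mul_comm]
  · have h := ENNReal.Tendsto.const_mul (a := ‖e‖ₑ ^ 2) hlim
      (Or.inr (ENNReal.pow_ne_top enorm_ne_top))
    rw [mul_zero] at h
    refine h.congr fun n => ?_
    rw [← lintegral_const_mul' _ _ (ENNReal.pow_ne_top enorm_ne_top)]
    refine lintegral_congr fun ω => ?_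
    rw [StepFun.integral_map, ContinuousLinearMap.coe_coe, hL, ← sub_smul, enorm_smul, mul_pow,
      mul_comm]

/-- The bound passes from the approximations to the limit with a crude factor `2`; it serves only to
make the series of modes summable. -/
theorem lintegral_integral_exp_sq_le (hH : H ∈ Set.Ioo (1 / 2 : ℝ) 1) (hw : IsFBm H T w P)
    (ht : 0 ≤ t) (htT : t ≤ T) {lam : ℝ} (hl : 0 < lam) {y : Ω → ℝ} (hy : MemLp y 2 P)
    (hlim : Tendsto (fun n => ∫⁻ ω, ‖y ω - (expStep lam ht n).integral w ω‖ₑ ^ 2 ∂P) atTop (𝓝 0)) :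
    ∫⁻ ω, ‖y ω‖ₑ ^ 2 ∂P ≤ 2 * (ENNReal.ofReal (lam ^ (-(2 * H))) * expEnergy H) := by
  have h := (ENNReal.Tendsto.const_mul (a := 2) hlim (Or.inr ENNReal.ofNat_ne_top)).add
    (tendsto_const_nhds (x := 2 * (ENNReal.ofReal (lam ^ (-(2 * H))) * expEnergy H)))
  rw [mul_zero, zero_add] at h
  refine ge_of_tendsto' h fun n => ?_
  have h1 := lintegral_enorm_sub_sq_le hy.aestronglyMeasurable
    ((expStep lam ht n).memLp_integral hw htT).aestronglyMeasurable
    (aestronglyMeasurable_const (b := (0 : ℝ)) (μ := P))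
  simp only [sub_zero] at h1
  refine h1.trans ?_
  gcongr
  exact lintegral_integral_expStep_sq_le hH hw ht htT hl n

end Integral

/-- Mean square convergence of finite sums. -/
theorem tendsto_lintegral_enorm_sum_sub_sq {Ω F ι : Type*} [MeasurableSpace Ω] {P : Measure Ω}
    [NormedAddCommGroup F] {X : ι → Ω → F} {S : ι → ℕ → Ω → F} (I : Finset ι)
    (hX : ∀ k, AEStronglyMeasurable (X k) P) (hS : ∀ k n, AEStronglyMeasurable (S k n) P)
    (h : ∀ k, Tendsto (fun n => ∫⁻ ω, ‖X k ω - S k n ω‖ₑ ^ 2 ∂P) atTop (𝓝 0)) :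
    Tendsto (fun n => ∫⁻ ω, ‖∑ k ∈ I, X k ω - ∑ k ∈ I, S k n ω‖ₑ ^ 2 ∂P) atTop (𝓝 0) := by
  classical
  induction I using Finset.induction_on with
  | empty => simp
  | insert k I hk ih =>
    have htwo : (2 : ℝ≥0∞) ≠ ∞ := ENNReal.ofNat_ne_top
    have h1 := (ENNReal.Tendsto.const_mul (h k) (Or.inr htwo)).add
      (ENNReal.Tendsto.const_mul ih (Or.inr htwo))
    simp only [mul_zero, add_zero] at h1
    refine tendsto_of_tendsto_of_tendsto_of_le_of_le tendsto_const_nhds h1 (fun _ => zero_le)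
      fun n => ?_
    have hm1 : AEMeasurable (fun ω => ‖X k ω - S k n ω‖ₑ ^ 2) P :=
      ((hX k).sub (hS k n)).enorm.pow_const 2
    have hm2 : AEMeasurable (fun ω => ‖∑ k ∈ I, X k ω - ∑ k ∈ I, S k n ω‖ₑ ^ 2) P :=
      ((Finset.aestronglyMeasurable_fun_sum _ fun k _ => hX k).sub
        (Finset.aestronglyMeasurable_fun_sum _ fun k _ => hS k n)).enorm.pow_const 2
    simp only
    rw [← lintegral_const_mul'' _ hm1, ← lintegral_const_mul'' _ hm2,
      ← lintegral_add_left' (hm1.const_mul _)]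
    refine lintegral_mono fun ω => le_trans ?_ (add_sq_le_two_mul_add _ _)
    rw [Finset.sum_insert hk, Finset.sum_insert hk, add_sub_add_comm]
    gcongr
    exact enorm_add_le _ _

/-! ### Gaussian moments of linear combinations of modes -/

section GaussianMoments

variable {Ω : Type*} [MeasurableSpace Ω] {P : Measure Ω}

/-- The moment of order `2r` of the standard normal distribution. -/
noncomputable def gaussMoment (r : ℕ) : ℝ≥0∞ := ∫⁻ x, ‖x‖ₑ ^ (2 * r) ∂gaussianReal 0 1

theorem gaussMoment_lt_top (r : ℕ) : gaussMoment r < ∞ := by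
  rcases Nat.eq_zero_or_pos r with rfl | hr
  · simp [gaussMoment]
  · have h := (memLp_id_gaussianReal (μ := 0) (v := 1) ((2 * r : ℕ) : NNReal)).eLpNorm_lt_top
    have h2 := eLpNorm_nnreal_pow_eq_lintegral (f := (id : ℝ → ℝ)) (μ := gaussianReal 0 1)
      (p := ((2 * r : ℕ) : NNReal)) (by positivity)
    have h3 : gaussMoment r = ∫⁻ x : ℝ, ‖id x‖ₑ ^ (((2 * r : ℕ) : NNReal) : ℝ) ∂gaussianReal 0 1 := by
      unfold gaussMoment
      refine lintegral_congr fun x => ?_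
      rw [NNReal.coe_natCast, ENNReal.rpow_natCast]
      rfl
    rw [h3, ← h2]
    exact ENNReal.rpow_lt_top_of_nonneg (by positivity) h.ne

/-- A centered Gaussian variable has the law of its standard deviation times a standard normal one,
so every even moment is a fixed multiple of a power of the second. -/
theorem lintegral_pow_of_hasGaussianLaw {Z : Ω → ℝ} (hZ : HasGaussianLaw Z P)
    (h0 : ∫ ω, Z ω ∂P = 0) (r : ℕ) :
    ∫⁻ ω, ‖Z ω‖ₑ ^ (2 * r) ∂P = gaussMoment r * (∫⁻ ω, ‖Z ω‖ₑ ^ 2 ∂P) ^ r := by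
  have hP : IsProbabilityMeasure P := hZ.isProbabilityMeasure
  have hlaw := hZ.map_eq_gaussianReal
  rw [h0] at hlaw
  set v : NNReal := (Var[Z; P]).toNNReal
  have hv : ∫⁻ ω, ‖Z ω‖ₑ ^ 2 ∂P = v := by
    have h1 : ENNReal.ofReal Var[Z; P] = evariance Z P := hZ.memLp_two.ofReal_variance_eq
    unfold evariance at h1
    rw [h0] at h1
    simp only [sub_zero] at h1
    rw [← h1]
    rfl
  have hsc : gaussianReal 0 v = (gaussianReal 0 1).map (Real.sqrt v * ·) := by
    rw [gaussianReal_map_const_mul, mul_zero, mul_one]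
    congr 1
    ext
    simp
  have hs : ‖Real.sqrt v‖ₑ ^ 2 = v := by
    rw [Real.enorm_of_nonneg (Real.sqrt_nonneg _), ← ENNReal.ofReal_pow (Real.sqrt_nonneg _),
      Real.sq_sqrt v.coe_nonneg, ENNReal.ofReal_coe_nnreal]
  calc ∫⁻ ω, ‖Z ω‖ₑ ^ (2 * r) ∂P = ∫⁻ x, ‖x‖ₑ ^ (2 * r) ∂(P.map Z) := by
        rw [lintegral_map' (by fun_prop) hZ.aemeasurable]
    _ = ∫⁻ x, ‖Real.sqrt v * x‖ₑ ^ (2 * r) ∂gaussianReal 0 1 := by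
        rw [hlaw, hsc, lintegral_map (by fun_prop) (by fun_prop)]
    _ = _ := by
        simp_rw [enorm_mul, mul_pow]
        rw [lintegral_const_mul _ (by fun_prop), pow_mul, hs, hv, mul_comm]
        rfl

end GaussianMoments

section FBm

variable {Ω : Type*} [MeasurableSpace Ω] {P : Measure Ω} {H T t : ℝ}

theorem StepFun.hasGaussianLaw_integral {w : ℝ → Ω → ℝ} (hw : IsFBm H T w P) (ht : t ≤ T)
    (f : StepFun ℝ t) : HasGaussianLaw (f.integral w) P := by
  classical
  have h := hw.gaussian.of_isGaussianProcess (S := Fin f.n) (F := ℝ)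
    (Y := fun i ω => (w (f.b i) ω - w (f.a i) ω) • f.c i) fun i =>
      -- Each weighted increment is a linear function of two coordinates of the process, so the
      -- family of increments is jointly Gaussian.
      ⟨{⟨f.b i, f.b_mem ht i⟩, ⟨f.a i, f.a_mem ht i⟩},
        { toFun x := (x ⟨⟨f.b i, f.b_mem ht i⟩, by simp⟩ - x ⟨⟨f.a i, f.a_mem ht i⟩, by simp⟩) • f.c i
          map_add' x y := by simp; ring
          map_smul' c x := by simp; ring }, by simp⟩
  exact h.hasGaussianLaw_fun_sum (I := Finset.univ)

theorem StepFun.integral_integral_eq_zero {w : ℝ → Ω → ℝ} (hw : IsFBm H T w P) (ht : t ≤ T)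
    (f : StepFun ℝ t) : ∫ ω, f.integral w ω ∂P = 0 := by
  have hP : IsProbabilityMeasure P := hw.gaussian.isProbabilityMeasure
  have hi : ∀ {s}, s ∈ Set.Icc 0 T → Integrable (w s) P := fun hs =>
    (hw.memLp_two hs).integrable one_le_two
  unfold StepFun.integral
  have hd : ∀ i, Integrable (fun ω => (w (f.b i) ω - w (f.a i) ω) • f.c i) P := fun i =>
    ((hi (f.b_mem ht i)).sub (hi (f.a_mem ht i))).smul_const _
  rw [integral_finsetSum _ fun i _ => hd i]
  refine Finset.sum_eq_zero fun i _ => ?_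
  rw [integral_smul_const, MeasureTheory.integral_sub (hi (f.b_mem ht i)) (hi (f.a_mem ht i)),
    hw.centered _ (f.a_mem ht i), hw.centered _ (f.b_mem ht i)]
  simp

/-- Elementary integrals with respect to independent fractional Brownian motions are independent. -/
theorem IsCylindricalFBm.iIndepFun_integral {w : ℕ → ℝ → Ω → ℝ} (hw : IsCylindricalFBm H T w P)
    (ht : t ≤ T) (f : ℕ → StepFun ℝ t) (a : ℕ → ℝ) :
    iIndepFun (fun k ω => a k * (f k).integral (w k) ω) P := by
  have h := hw.indep.comp (fun k x => a k * ∑ i, (x ⟨(f k).b i, (f k).b_mem ht i⟩ -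
    x ⟨(f k).a i, (f k).a_mem ht i⟩) • (f k).c i) fun k => by fun_prop
  exact h

/-- A sum of independent centered Gaussian variables is centered Gaussian, so its moments are
governed by its variance, and variances add. -/
theorem IsCylindricalFBm.lintegral_sum_integral_pow_le {w : ℕ → ℝ → Ω → ℝ}
    (hw : IsCylindricalFBm H T w P) (ht : t ≤ T) (f : ℕ → StepFun ℝ t) (a : ℕ → ℝ) (I : Finset ℕ)
    (r : ℕ) :
    ∫⁻ ω, ‖∑ k ∈ I, a k * (f k).integral (w k) ω‖ₑ ^ (2 * r) ∂P ≤
      gaussMoment r * (∑ k ∈ I, ‖a k‖ₑ ^ 2 * ∫⁻ ω, ‖(f k).integral (w k) ω‖ₑ ^ 2 ∂P) ^ r := by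
  have hP : IsProbabilityMeasure P := (hw.isFBm 0).gaussian.isProbabilityMeasure
  set X : ℕ → Ω → ℝ := fun k ω => a k * (f k).integral (w k) ω with hX
  have hind : iIndepFun X P := hw.iIndepFun_integral ht f a
  have hG : ∀ k, HasGaussianLaw (X k) P := fun k =>
    (StepFun.hasGaussianLaw_integral (hw.isFBm k) ht (f k)).fun_smul (a k)
  have h0 : ∀ k, ∫ ω, X k ω ∂P = 0 := fun k => by
    rw [hX, integral_const_mul, StepFun.integral_integral_eq_zero (hw.isFBm k) ht, mul_zero]
  have hsum : HasGaussianLaw (fun ω => ∑ k ∈ I, X k ω) P := by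
    have h := iIndepFun.hasGaussianLaw_fun_sum (X := fun k : I => X k) (fun k => hG k)
      (hind.precomp Subtype.val_injective)
    refine h.congr (ae_of_all _ fun ω => ?_)
    exact Finset.sum_coe_sort I fun k => X k ω
  have hsum0 : ∫ ω, ∑ k ∈ I, X k ω ∂P = 0 := by
    rw [integral_finsetSum _ fun k _ => (hG k).integrable]
    exact Finset.sum_eq_zero fun k _ => h0 k
  have hsq : ∀ {Z : Ω → ℝ}, HasGaussianLaw Z P → ∫ ω, Z ω ∂P = 0 →
      ∫⁻ ω, ‖Z ω‖ₑ ^ 2 ∂P = ENNReal.ofReal Var[Z; P] := by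
    intro Z hZ h0
    rw [hZ.memLp_two.ofReal_variance_eq, evariance, h0]
    simp only [sub_zero]
  rw [lintegral_pow_of_hasGaussianLaw hsum hsum0]
  gcongr
  have hvar : Var[fun ω => ∑ k ∈ I, X k ω; P] = ∑ k ∈ I, Var[X k; P] := by
    have := IndepFun.variance_sum (X := X) (s := I) (fun k _ => (hG k).memLp_two)
      (fun i _ j _ hij => hind.indepFun hij)
    rw [← this]
    congr 1
    ext ω
    simp
  rw [hsq hsum hsum0, hvar, ENNReal.ofReal_sum_of_nonneg fun k _ => variance_nonneg _ _]
  refine Finset.sum_le_sum fun k _ => ?_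
  rw [← hsq (hG k) (h0 k), ← lintegral_const_mul' _ _ (ENNReal.pow_ne_top enorm_ne_top)]
  refine lintegral_mono fun ω => ?_
  rw [hX, enorm_mul, mul_pow]

/-- Even moments of linear combinations of the integrals `∫₀ᵗ e^{-λ_k(t - s)} dw_k(s)`. -/
theorem IsCylindricalFBm.lintegral_sum_pow_le {w : ℕ → ℝ → Ω → ℝ}
    (hH : H ∈ Set.Ioo (1 / 2 : ℝ) 1) (hw : IsCylindricalFBm H T w P) (ht : 0 ≤ t) (htT : t ≤ T)
    {lam : ℕ → ℝ} (hl : ∀ k, 0 < lam k) {y : ℕ → Ω → ℝ} (hy : ∀ k, MemLp (y k) 2 P)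
    (hlim : ∀ k, Tendsto (fun n => ∫⁻ ω, ‖y k ω - (expStep (lam k) ht n).integral (w k) ω‖ₑ ^ 2 ∂P)
      atTop (𝓝 0)) (a : ℕ → ℝ) (I : Finset ℕ) (r : ℕ) :
    ∫⁻ ω, ‖∑ k ∈ I, a k * y k ω‖ₑ ^ (2 * r) ∂P ≤ gaussMoment r *
      (∑ k ∈ I, ‖a k‖ₑ ^ 2 * (ENNReal.ofReal (lam k ^ (-(2 * H))) * expEnergy H)) ^ r := by
  set S : ℕ → Ω → ℝ := fun n ω => ∑ k ∈ I, a k * (expStep (lam k) ht n).integral (w k) ω with hS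
  have hmi : ∀ k n, AEStronglyMeasurable ((expStep (lam k) ht n).integral (w k)) P := fun k n =>
    ((expStep (lam k) ht n).memLp_integral (hw.isFBm k) htT).aestronglyMeasurable
  have hSm : ∀ n, AEStronglyMeasurable (S n) P := fun n =>
    Finset.aestronglyMeasurable_fun_sum _ fun k _ => (hmi k n).const_mul _
  obtain ⟨ns, hns, hae⟩ : ∃ ns : ℕ → ℕ, StrictMono ns ∧
      ∀ᵐ ω ∂P, Tendsto (fun i => S (ns i) ω) atTop (𝓝 (∑ k ∈ I, a k * y k ω)) := by
    refine exists_seq_tendsto_ae_of_tendsto_lintegral_enorm_sub_sq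
      (Finset.aestronglyMeasurable_fun_sum _ fun k _ => (hy k).aestronglyMeasurable.const_mul _)
      hSm ?_
    refine tendsto_lintegral_enorm_sum_sub_sq (X := fun k ω => a k * y k ω) I
      (fun k => (hy k).aestronglyMeasurable.const_mul _) (fun k n => (hmi k n).const_mul _)
      fun k => ?_
    have h := ENNReal.Tendsto.const_mul (a := ‖a k‖ₑ ^ 2) (hlim k)
      (Or.inr (ENNReal.pow_ne_top enorm_ne_top))
    rw [mul_zero] at h
    refine h.congr fun n => ?_
    rw [← lintegral_const_mul' _ _ (ENNReal.pow_ne_top enorm_ne_top)]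
    refine lintegral_congr fun ω => ?_
    rw [← mul_sub, enorm_mul, mul_pow]
  -- Fatou's lemma along an almost surely convergent subsequence of elementary integrals transfers
  -- the bound, so neither the law nor the independence of the limits `y k` is needed.
  calc ∫⁻ ω, ‖∑ k ∈ I, a k * y k ω‖ₑ ^ (2 * r) ∂P
      = ∫⁻ ω, liminf (fun i => ‖S (ns i) ω‖ₑ ^ (2 * r)) atTop ∂P := by
        refine lintegral_congr_ae ?_
        filter_upwards [hae] with ω hω
        exact ((ENNReal.Tendsto.pow hω.enorm).liminf_eq).symm
    _ ≤ liminf (fun i => ∫⁻ ω, ‖S (ns i) ω‖ₑ ^ (2 * r) ∂P) atTop :=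
        lintegral_liminf_le' fun i => (hSm _).enorm.pow_const _
    _ ≤ liminf (fun _ : ℕ => gaussMoment r *
          (∑ k ∈ I, ‖a k‖ₑ ^ 2 * (ENNReal.ofReal (lam k ^ (-(2 * H))) * expEnergy H)) ^ r) atTop := by
        refine liminf_le_liminf (Eventually.of_forall fun i => ?_)
        refine (hw.lintegral_sum_integral_pow_le htT (fun k => expStep (lam k) ht (ns i)) a I r).trans ?_
        gcongr with k _
        exact lintegral_integral_expStep_sq_le hH (hw.isFBm k) ht htT (hl k) _
    _ = _ := by simp

end FBm

/-! ### Sine basis, semigroups and projections -/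

theorem integral_cos_int_mul_pi (m : ℤ) :
    ∫ x in (0 : ℝ)..1, Real.cos (m * Real.pi * x) = if m = 0 then 1 else 0 := by
  split_ifs with h
  · simp [h]
  · have hm : (m : ℝ) * Real.pi ≠ 0 := mul_ne_zero (by exact_mod_cast h) Real.pi_ne_zero
    rw [intervalIntegral.integral_comp_mul_left (fun x => Real.cos x) hm, integral_cos]
    simp [Real.sin_int_mul_pi]

/-- The product-to-sum formula leaves cosines of frequencies `j - k` and `j + k + 2`. The second is
never zero because modes are numbered from one, so only the diagonal survives. -/
theorem inner_eigenfun (j k : ℕ) :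
    inner ℝ (eigenfun (j + 1)) (eigenfun (k + 1)) = if j = k then (1 : ℝ) else 0 := by
  rw [L2.inner_def]
  have h1 : ∫ x, inner ℝ (eigenfun (j + 1) x) (eigenfun (k + 1) x) ∂domMeasure =
      ∫ x, (Real.cos (((j - k : ℤ) : ℝ) * Real.pi * x) -
        Real.cos (((j + k + 2 : ℤ) : ℝ) * Real.pi * x)) ∂domMeasure := by
    refine integral_congr_ae ?_
    filter_upwards [(memLp_sine (j + 1)).coeFn_toLp, (memLp_sine (k + 1)).coeFn_toLp] with x h1 h2
    rw [eigenfun, eigenfun, h1, h2]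
    have h3 : Real.sqrt 2 * Real.sqrt 2 = 2 := Real.mul_self_sqrt (by norm_num)
    have h4 : ((j - k : ℤ) : ℝ) * Real.pi * x =
        (j + 1 : ℕ) * Real.pi * x - (k + 1 : ℕ) * Real.pi * x := by push_cast; ring
    have h5 : ((j + k + 2 : ℤ) : ℝ) * Real.pi * x =
        (j + 1 : ℕ) * Real.pi * x + (k + 1 : ℕ) * Real.pi * x := by push_cast; ring
    rw [h4, h5, Real.cos_sub, Real.cos_add]
    simp only [RCLike.inner_apply, conj_trivial]
    linear_combination (Real.sin ((k + 1 : ℕ) * Real.pi * x) *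
      Real.sin ((j + 1 : ℕ) * Real.pi * x)) * h3
  rw [h1, ← integral_Ioc_eq_integral_Ioo, ← intervalIntegral.integral_of_le zero_le_one,
    intervalIntegral.integral_sub, integral_cos_int_mul_pi, integral_cos_int_mul_pi]
  · have h6 : ¬ ((j : ℤ) + k + 2 = 0) := by omega
    rw [if_neg h6, sub_zero]
    congr 1
    rw [sub_eq_zero, Nat.cast_inj]
  all_goals exact (by fun_prop : Continuous _).intervalIntegrable _ _

theorem orthonormal_eigenfun : Orthonormal ℝ fun k : ℕ => eigenfun (k + 1) := by
  rw [orthonormal_iff_ite]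
  exact inner_eigenfun

theorem semigroup_eigenfun (t : ℝ) (k : ℕ) :
    semigroup t (eigenfun (k + 1)) = Real.exp (-eigenval (k + 1) * t) • eigenfun (k + 1) := by
  unfold semigroup
  rw [tsum_eq_single k]
  · rw [inner_eigenfun, if_pos rfl, mul_one]
  · intro j hj
    rw [inner_eigenfun, if_neg hj, mul_zero, zero_smul]

theorem galerkinProj_eigenfun (N k : ℕ) :
    galerkinProj N (eigenfun (k + 1)) = if k < N then eigenfun (k + 1) else 0 := by
  unfold galerkinProj
  split_ifs with h
  · rw [Submodule.starProjection_eq_self_iff]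
    exact Submodule.subset_span ⟨k + 1, ⟨by omega, by omega⟩, rfl⟩
  · rw [Submodule.starProjection_apply_eq_zero_iff]
    unfold galerkinSpace
    rw [Submodule.mem_orthogonal]
    intro u hu
    induction hu using Submodule.span_induction with
    | mem x hx =>
      obtain ⟨j, hj, rfl⟩ := hx
      obtain ⟨i, rfl⟩ := Nat.exists_eq_add_of_le' hj.1
      rw [inner_eigenfun, if_neg]
      have := hj.2
      omega
    | zero => simp
    | add x y _ _ hx hy => rw [inner_add_left, hx, hy, add_zero]
    | smul c x _ hx => rw [real_inner_smul_left, hx, mul_zero]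

theorem galerkinSemigroup_galerkinProj_eigenfun (N : ℕ) (t : ℝ) (k : ℕ) :
    galerkinSemigroup N t (galerkinProj N (eigenfun (k + 1))) =
      Real.exp (-eigenval (k + 1) * t) • if k < N then eigenfun (k + 1) else 0 := by
  rw [galerkinProj_eigenfun]
  unfold galerkinSemigroup
  split_ifs with h
  · rw [Finset.sum_eq_single (k + 1)]
    · rw [inner_eigenfun, if_pos rfl, mul_one]
    · intro j hj hjk
      obtain ⟨i, rfl⟩ := Nat.exists_eq_add_of_le' (Finset.mem_Icc.1 hj).1
      rw [inner_eigenfun, if_neg (by omega), mul_zero, zero_smul]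
    · intro h'
      exact absurd (Finset.mem_Icc.2 ⟨by omega, by omega⟩) h'
  · simp

theorem eigenval_pos (k : ℕ) : 0 < eigenval (k + 1) := by
  unfold eigenval
  positivity

/-! ### Sup norm estimates and auxiliary inequalities -/

/-- A sup norm bound for functions vanishing at the origin. -/
theorem enorm_pow_le_lintegral {g g' : ℝ → ℝ} (hg : ∀ x, HasDerivAt g (g' x) x)
    (hg' : Continuous g') (h0 : g 0 = 0) {M : ℝ} (hM : 0 < M) (n : ℕ) {x : ℝ}
    (hx : x ∈ Set.Ioo (0 : ℝ) 1) :
    ‖g x‖ₑ ^ (n + 1) ≤ ENNReal.ofReal ((n + 1) * M) *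
      ∫⁻ s, (‖g s‖ₑ ^ (n + 1) + ‖g' s / M‖ₑ ^ (n + 1)) ∂domMeasure := by
  have hgc : Continuous g := continuous_iff_continuousAt.2 fun x => (hg x).continuousAt
  -- The boundary term vanishes since `g 0 = 0`, so the power is the integral of its own derivative.
  have hF : ∫ s in (0 : ℝ)..x, (((n + 1 : ℕ) : ℝ) * g s ^ n * g' s) = g x ^ (n + 1) := by
    rw [intervalIntegral.integral_eq_sub_of_hasDerivAt (f := fun s => g s ^ (n + 1))]
    · simp [h0]
    · intro s _
      exact (hg s).pow (n + 1)
    · exact (by fun_prop : Continuous _).intervalIntegrable _ _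
  have hpt : ∀ s, ‖((n + 1 : ℕ) : ℝ) * g s ^ n * g' s‖ₑ ≤ ENNReal.ofReal ((n + 1) * M) *
      (‖g s‖ₑ ^ (n + 1) + ‖g' s / M‖ₑ ^ (n + 1)) := by
    intro s
    have e : ((n + 1 : ℕ) : ℝ) * g s ^ n * g' s = ((n + 1) * M) * (g s ^ n * (g' s / M)) := by
      field_simp
      push_cast
      ring
    rw [e, enorm_mul, Real.enorm_of_nonneg (by positivity)]
    gcongr
    rw [enorm_mul, enorm_pow]
    -- The mixed product `a^n b` is at most the larger of `a^(n+1)` and `b^(n+1)`. The scale `M` is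
    -- free; later it is the frequency of the block, which balances the two terms.
    rcases le_total ‖g s‖ₑ ‖g' s / M‖ₑ with h | h
    · refine le_add_left ?_
      rw [pow_succ]
      gcongr
    · refine le_add_right ?_
      rw [pow_succ]
      gcongr
  rw [← enorm_pow, ← hF, intervalIntegral.integral_of_le hx.1.le]
  refine (enorm_integral_le_lintegral_enorm _).trans ?_
  rw [← lintegral_const_mul' _ _ ENNReal.ofReal_ne_top]
  refine (lintegral_mono hpt).trans ?_
  exact lintegral_mono_set fun s hs => ⟨hs.1, hs.2.trans_lt hx.2⟩

/-- The sine polynomial `∑ c_k φ_{k + 1}` as a function. -/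
noncomputable def sinePoly (I : Finset ℕ) (c : ℕ → ℝ) (x : ℝ) : ℝ :=
  ∑ k ∈ I, c k * (Real.sqrt 2 * Real.sin ((k + 1 : ℕ) * Real.pi * x))

/-- The derivative of a sine polynomial. -/
noncomputable def sinePolyDeriv (I : Finset ℕ) (c : ℕ → ℝ) (x : ℝ) : ℝ :=
  ∑ k ∈ I, c k * (Real.sqrt 2 * (Real.cos ((k + 1 : ℕ) * Real.pi * x) * ((k + 1 : ℕ) * Real.pi)))

theorem hasDerivAt_sinePoly (I : Finset ℕ) (c : ℕ → ℝ) (x : ℝ) :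
    HasDerivAt (sinePoly I c) (sinePolyDeriv I c x) x := by
  unfold sinePoly sinePolyDeriv
  refine HasDerivAt.fun_sum fun k _ => ((HasDerivAt.const_mul _ ?_).const_mul _)
  have h := (hasDerivAt_id x).const_mul ((k + 1 : ℕ) * Real.pi)
  rw [mul_one] at h
  exact h.sin

theorem supNorm_sum_pow_le (I : Finset ℕ) (c : ℕ → ℝ) {M : ℝ} (hM : 0 < M) (n : ℕ) :
    supNorm (∑ k ∈ I, c k • eigenfun (k + 1)) ^ (n + 1) ≤ ENNReal.ofReal ((n + 1) * M) *
      ∫⁻ s, (‖sinePoly I c s‖ₑ ^ (n + 1) + ‖sinePolyDeriv I c s / M‖ₑ ^ (n + 1)) ∂domMeasure := by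
  set B := ENNReal.ofReal ((n + 1) * M) *
      ∫⁻ s, (‖sinePoly I c s‖ₑ ^ (n + 1) + ‖sinePolyDeriv I c s / M‖ₑ ^ (n + 1)) ∂domMeasure
  have hcoe : (∑ k ∈ I, c k • eigenfun (k + 1) : U) =ᵐ[domMeasure] sinePoly I c := by
    have h : ∀ k, ((c k • eigenfun (k + 1) : U) : ℝ → ℝ) =ᵐ[domMeasure]
        fun x => c k * (Real.sqrt 2 * Real.sin ((k + 1 : ℕ) * Real.pi * x)) := by
      intro k
      filter_upwards [Lp.coeFn_smul (c k) (eigenfun (k + 1)), (memLp_sine (k + 1)).coeFn_toLp]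
        with x h1 h2
      rw [h1, Pi.smul_apply, eigenfun, h2, smul_eq_mul]
    have h' : ∀ᵐ x ∂domMeasure, ∀ k ∈ I, (c k • eigenfun (k + 1) : U) x =
        c k * (Real.sqrt 2 * Real.sin ((k + 1 : ℕ) * Real.pi * x)) :=
      (ae_ball_iff I.countable_toSet).2 fun k _ => h k
    have hs : ∀ J : Finset ℕ, (∑ k ∈ J, c k • eigenfun (k + 1) : U) =ᵐ[domMeasure]
        fun x => ∑ k ∈ J, (c k • eigenfun (k + 1) : U) x := by
      intro J
      induction J using Finset.induction_on with
      | empty =>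
        filter_upwards [Lp.coeFn_zero ℝ 2 domMeasure] with x hx
        simpa using hx
      | insert k J hk ih =>
        rw [Finset.sum_insert hk]
        filter_upwards [Lp.coeFn_add (c k • eigenfun (k + 1)) (∑ k ∈ J, c k • eigenfun (k + 1)), ih]
          with x h1 h2
        rw [h1, Pi.add_apply, h2, Finset.sum_insert hk]
    filter_upwards [hs I, h'] with x h1 h2
    rw [h1, sinePoly]
    exact Finset.sum_congr rfl h2
  have hle : supNorm (∑ k ∈ I, c k • eigenfun (k + 1)) ≤ B ^ ((n + 1 : ℕ) : ℝ)⁻¹ := by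
    unfold supNorm
    rw [eLpNorm_congr_ae hcoe, eLpNorm_exponent_top]
    refine essSup_le_of_ae_le _ ?_
    filter_upwards [ae_restrict_mem measurableSet_Ioo] with x hx
    have h := enorm_pow_le_lintegral (hasDerivAt_sinePoly I c)
      (by unfold sinePolyDeriv; fun_prop) (by simp [sinePoly]) hM n hx
    rw [ENNReal.le_rpow_inv_iff (by positivity), ENNReal.rpow_natCast]
    exact h
  calc _ ≤ (B ^ ((n + 1 : ℕ) : ℝ)⁻¹) ^ (n + 1) := by gcongr
    _ = B := by
      rw [← ENNReal.rpow_natCast, ← ENNReal.rpow_mul, inv_mul_cancel₀ (by positivity),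
        ENNReal.rpow_one]

/-- The sup norm is lower semicontinuous with respect to convergence in `L²`. -/
theorem supNorm_le_of_tendsto {u : ℕ → U} {v : U} (h : Tendsto u atTop (𝓝 v)) {c : ℝ≥0∞}
    (hc : ∀ n, supNorm (u n) ≤ c) : supNorm v ≤ c := by
  obtain ⟨ns, -, hns⟩ := (tendstoInMeasure_of_tendsto_Lp h).exists_seq_tendsto_ae
  have h1 : ∀ᵐ x ∂domMeasure, ∀ n, ‖u n x‖ₑ ≤ c := by
    rw [ae_all_iff]
    intro n
    have h2 := hc n
    unfold supNorm at h2
    rw [eLpNorm_exponent_top] at h2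
    filter_upwards [enorm_ae_le_eLpNormEssSup (u n) domMeasure] with x hx using hx.trans h2
  unfold supNorm
  rw [eLpNorm_exponent_top]
  refine essSup_le_of_ae_le _ ?_
  filter_upwards [hns, h1] with x hx hx1
  exact le_of_tendsto' hx.enorm fun i => hx1 _

/-- Minkowski's inequality for series. -/
theorem lintegral_tsum_rpow_le {Ω : Type*} [MeasurableSpace Ω] {P : Measure Ω}
    {G : ℕ → Ω → ℝ≥0∞} (hG : ∀ j, AEMeasurable (G j) P) {q : ℝ} (hq : 1 ≤ q) :
    (∫⁻ ω, (∑' j, G j ω) ^ q ∂P) ^ (1 / q) ≤ ∑' j, (∫⁻ ω, G j ω ^ q ∂P) ^ (1 / q) := by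
  have hq0 : 0 < q := one_pos.trans_le hq
  have hfin : ∀ n, (∫⁻ ω, (∑ j ∈ Finset.range n, G j ω) ^ q ∂P) ^ (1 / q) ≤
      ∑ j ∈ Finset.range n, (∫⁻ ω, G j ω ^ q ∂P) ^ (1 / q) := by
    intro n
    induction n with
    | zero => simp [hq0]
    | succ n ih =>
      simp_rw [Finset.sum_range_succ]
      refine le_trans ?_ (add_le_add_left ih _)
      exact ENNReal.lintegral_Lp_add_le
        (f := fun ω => ∑ j ∈ Finset.range n, G j ω) (Finset.aemeasurable_fun_sum _ fun j _ => hG j) (hG n) hq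
  set B := ∑' j, (∫⁻ ω, G j ω ^ q ∂P) ^ (1 / q)
  have hB : ∫⁻ ω, (∑' j, G j ω) ^ q ∂P ≤ B ^ q := by
    calc ∫⁻ ω, (∑' j, G j ω) ^ q ∂P
        = ∫⁻ ω, liminf (fun n => (∑ j ∈ Finset.range n, G j ω) ^ q) atTop ∂P := by
          refine lintegral_congr fun ω => ?_
          exact ((ENNReal.tendsto_nat_tsum fun j => G j ω).ennrpow_const q).liminf_eq.symm
      _ ≤ liminf (fun n => ∫⁻ ω, (∑ j ∈ Finset.range n, G j ω) ^ q ∂P) atTop :=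
          lintegral_liminf_le' fun n =>
            (Finset.aemeasurable_fun_sum _ fun j _ => hG j).pow_const _
      _ ≤ liminf (fun _ : ℕ => B ^ q) atTop := by
          refine liminf_le_liminf (Eventually.of_forall fun n => ?_)
          rw [← ENNReal.rpow_inv_le_iff hq0, ← one_div]
          exact (hfin n).trans (ENNReal.sum_le_tsum _)
      _ = B ^ q := by simp
  rw [one_div, ENNReal.rpow_inv_le_iff hq0]
  exact hB

theorem lintegral_rpow_one_div_mono {Ω : Type*} [MeasurableSpace Ω] {P : Measure Ω}
    [IsProbabilityMeasure P] {G : Ω → ℝ≥0∞} (hG : AEMeasurable G P) {p q : ℝ} (hp : 0 < p)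
    (hpq : p ≤ q) : (∫⁻ ω, G ω ^ p ∂P) ^ (1 / p) ≤ (∫⁻ ω, G ω ^ q ∂P) ^ (1 / q) := by
  have h := eLpNorm'_le_eLpNorm'_of_exponent_le hp hpq P hG.aestronglyMeasurable
  simpa only [eLpNorm', enorm_eq_self] using h

theorem supNorm_sum_le {ι : Type*} (I : Finset ι) (u : ι → U) :
    supNorm (∑ i ∈ I, u i) ≤ ∑ i ∈ I, supNorm (u i) := by
  classical
  induction I using Finset.induction_on with
  | empty =>
    rw [Finset.sum_empty, Finset.sum_empty, supNorm, eLpNorm_congr_ae (Lp.coeFn_zero ℝ 2 domMeasure)]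
    simp
  | insert i I hi ih =>
    rw [Finset.sum_insert hi, Finset.sum_insert hi]
    refine le_trans ?_ (add_le_add_right ih _)
    unfold supNorm
    rw [eLpNorm_congr_ae (Lp.coeFn_add _ _)]
    exact eLpNorm_add_le (Lp.aestronglyMeasurable _) (Lp.aestronglyMeasurable _) le_top

theorem enorm_sum_smul_eigenfun_sq (I : Finset ℕ) (c : ℕ → ℝ) :
    ‖∑ k ∈ I, c k • eigenfun (k + 1)‖ₑ ^ 2 = ∑ k ∈ I, ‖c k‖ₑ ^ 2 := by
  have h : ‖∑ k ∈ I, c k • eigenfun (k + 1)‖ ^ 2 = ∑ k ∈ I, ‖c k‖ ^ 2 := by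
    rw [← real_inner_self_eq_norm_sq, orthonormal_eigenfun.inner_sum]
    refine Finset.sum_congr rfl fun k _ => ?_
    rw [Real.norm_eq_abs, sq_abs, sq]
    rfl
  simp_rw [← ofReal_norm]
  rw [← ENNReal.ofReal_pow (norm_nonneg _), h, ENNReal.ofReal_sum_of_nonneg fun _ _ => by positivity]
  simp_rw [ENNReal.ofReal_pow (norm_nonneg _)]

/-- The eigenvalue dominates `(k + 1)²`, hence `m²`. It is used with `m = k + 1` for summability and
with `m` the lowest mode of a dyadic block. -/
theorem eigenval_rpow_le {H : ℝ} (hH : 0 ≤ H) {m : ℝ} (hm : 0 < m) {k : ℕ} (hk : m ≤ (k : ℝ) + 1) :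
    eigenval (k + 1) ^ (-(2 * H)) ≤ m ^ (-(4 * H)) := by
  have h1 : m ^ (-(4 * H)) = (m ^ 2) ^ (-(2 * H)) := by
    rw [← Real.rpow_natCast, ← Real.rpow_mul hm.le]
    congr 1
    push_cast
    ring
  rw [h1]
  refine Real.rpow_le_rpow_of_nonpos (by positivity) ?_ (by linarith)
  unfold eigenval
  push_cast
  have h2 : 1 ≤ Real.pi ^ 2 := one_le_pow₀ (by linarith [Real.pi_gt_three])
  calc m ^ 2 ≤ ((k : ℝ) + 1) ^ 2 * 1 := by rw [mul_one]; gcongr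
    _ ≤ _ := by gcongr

theorem tsum_eigenval_rpow_ne_top {H : ℝ} (hH : 1 / 2 < H) :
    ∑' k : ℕ, ENNReal.ofReal (eigenval (k + 1) ^ (-(2 * H))) ≠ ∞ := by
  have hs : Summable fun k : ℕ => ((k + 1 : ℕ) : ℝ) ^ (-(4 * H)) :=
    (summable_nat_add_iff 1).2 (Real.summable_nat_rpow.2 (by linarith))
  refine ne_top_of_le_ne_top hs.tsum_ofReal_ne_top ?_
  refine ENNReal.tsum_le_tsum fun k => ENNReal.ofReal_le_ofReal ?_
  exact eigenval_rpow_le (by linarith) (by positivity) (by push_cast; rfl)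

/-! ### Moment bound for one block of modes -/

section Block

variable {Ω : Type*} [MeasurableSpace Ω] {P : Measure Ω} {H T t : ℝ} {w : ℕ → ℝ → Ω → ℝ}

/-- A random upper bound for the power `n + 1` of the sup norm of `∑ y_k φ_{k + 1}`. -/
noncomputable def blockBound (I : Finset ℕ) (y : ℕ → Ω → ℝ) (M : ℝ) (n : ℕ) (ω : Ω) : ℝ≥0∞ :=
  ENNReal.ofReal ((n + 1) * M) * ∫⁻ s, (‖sinePoly I (fun k => y k ω) s‖ₑ ^ (n + 1) +
    ‖sinePolyDeriv I (fun k => y k ω) s / M‖ₑ ^ (n + 1)) ∂domMeasure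

/-- Joint measurability is what permits exchanging expectation and the space integral. -/
theorem aemeasurable_blockBound_integrand [SFinite P] (I : Finset ℕ) {y : ℕ → Ω → ℝ}
    (hy : ∀ k, AEMeasurable (y k) P) (M : ℝ) (n : ℕ) :
    AEMeasurable (fun z : Ω × ℝ => ‖sinePoly I (fun k => y k z.1) z.2‖ₑ ^ (n + 1) +
      ‖sinePolyDeriv I (fun k => y k z.1) z.2 / M‖ₑ ^ (n + 1)) (P.prod domMeasure) := by
  have h : ∀ {F : ℕ → ℝ → ℝ}, (∀ k, Measurable (F k)) →
      AEMeasurable (fun z : Ω × ℝ => ∑ k ∈ I, y k z.1 * F k z.2) (P.prod domMeasure) := by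
    intro F hF
    exact Finset.aemeasurable_fun_sum _ fun k _ =>
      (hy k).comp_fst.mul ((hF k).comp measurable_snd).aemeasurable
  have h1 : AEMeasurable (fun z : Ω × ℝ => sinePoly I (fun k => y k z.1) z.2) (P.prod domMeasure) :=
    h (F := fun k x => Real.sqrt 2 * Real.sin ((k + 1 : ℕ) * Real.pi * x)) fun k => by fun_prop
  have h2 : AEMeasurable (fun z : Ω × ℝ => sinePolyDeriv I (fun k => y k z.1) z.2)
      (P.prod domMeasure) :=
    h (F := fun k x => Real.sqrt 2 * (Real.cos ((k + 1 : ℕ) * Real.pi * x) *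
      ((k + 1 : ℕ) * Real.pi))) fun k => by fun_prop
  exact (h1.enorm.pow_const _).add ((h2.div_const M).enorm.pow_const _)

theorem aemeasurable_blockBound [SFinite P] (I : Finset ℕ) {y : ℕ → Ω → ℝ}
    (hy : ∀ k, AEMeasurable (y k) P) (M : ℝ) (n : ℕ) : AEMeasurable (blockBound I y M n) P :=
  (aemeasurable_blockBound_integrand I hy M n).lintegral_prod_right'.const_mul _

/-- The constant in the moment bound for blocks of modes. -/
noncomputable def blockConst (H : ℝ) (r : ℕ) : ℝ≥0∞ :=
  ENNReal.ofReal (2 * r) * (2 * (gaussMoment r * (ENNReal.ofReal (8 * Real.pi ^ 2) * expEnergy H) ^ r))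

theorem blockConst_lt_top (hH : H ∈ Set.Ioo (1 / 2 : ℝ) 1) (r : ℕ) : blockConst H r < ∞ := by
  unfold blockConst
  refine ENNReal.mul_lt_top ENNReal.ofReal_lt_top (ENNReal.mul_lt_top ENNReal.ofNat_lt_top
    (ENNReal.mul_lt_top (gaussMoment_lt_top r) (ENNReal.pow_lt_top (ENNReal.mul_lt_top
      ENNReal.ofReal_lt_top (expEnergy_lt_top hH)))))

/-- By Tonelli the expectation is taken at a fixed point `s`, where the sine polynomial and its
scaled derivative are linear combinations of modes with bounded coefficients. At most `m` terms,
each of variance of order `m^{-4H}`, give `m^{(1-4H)r}`; the remaining factor `m` is the scale in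
the sup norm estimate. -/
theorem lintegral_blockBound_le [IsProbabilityMeasure P] (hH : H ∈ Set.Ioo (1 / 2 : ℝ) 1)
    (hw : IsCylindricalFBm H T w P) (ht : 0 ≤ t) (htT : t ≤ T) {y : ℕ → Ω → ℝ}
    (hy : ∀ k, MemLp (y k) 2 P)
    (hlim : ∀ k, Tendsto (fun n => ∫⁻ ω, ‖y k ω -
      (expStep (eigenval (k + 1)) ht n).integral (w k) ω‖ₑ ^ 2 ∂P) atTop (𝓝 0))
    {I : Finset ℕ} {m : ℝ} (hm : 0 < m) (hI : ∀ k ∈ I, m ≤ (k : ℝ) + 1 ∧ (k : ℝ) + 1 ≤ 2 * m)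
    (hcard : (I.card : ℝ) ≤ m) {n r : ℕ} (hn : n + 1 = 2 * r) :
    ∫⁻ ω, blockBound I y m n ω ∂P ≤
      blockConst H r * ENNReal.ofReal (m ^ (1 + (1 - 4 * H) * r)) := by
  set D := expEnergy H
  set W : ℝ≥0∞ := ENNReal.ofReal (m ^ (1 - 4 * H)) * (ENNReal.ofReal (8 * Real.pi ^ 2) * D)
  -- The constant `8π² = (√2 · 2π)²` covers both uses: derivative coefficients are at most
  -- `√2(k+1)π/m` with `k + 1 ≤ 2m`, and sine coefficients are at most `√2`.
  have hmom : ∀ a : ℕ → ℝ, (∀ k ∈ I, a k ^ 2 ≤ 8 * Real.pi ^ 2) →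
      ∫⁻ ω, ‖∑ k ∈ I, a k * y k ω‖ₑ ^ (n + 1) ∂P ≤ gaussMoment r * W ^ r := by
    intro a ha
    rw [hn]
    refine (hw.lintegral_sum_pow_le hH ht htT (lam := fun k => eigenval (k + 1)) eigenval_pos hy
      hlim a I r).trans ?_
    gcongr
    calc ∑ k ∈ I, ‖a k‖ₑ ^ 2 * (ENNReal.ofReal (eigenval (k + 1) ^ (-(2 * H))) * D)
        ≤ ∑ k ∈ I, ENNReal.ofReal (8 * Real.pi ^ 2) * (ENNReal.ofReal (m ^ (-(4 * H))) * D) := by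
          refine Finset.sum_le_sum fun k hk => ?_
          gcongr
          · rw [← enorm_pow, Real.enorm_of_nonneg (sq_nonneg _)]
            exact ENNReal.ofReal_le_ofReal (ha k hk)
          · exact eigenval_rpow_le (by linarith [hH.1]) hm (hI k hk).1
      _ = ENNReal.ofReal I.card * (ENNReal.ofReal (8 * Real.pi ^ 2) *
            (ENNReal.ofReal (m ^ (-(4 * H))) * D)) := by
          rw [Finset.sum_const, nsmul_eq_mul, ENNReal.ofReal_natCast]
      _ ≤ ENNReal.ofReal m * (ENNReal.ofReal (8 * Real.pi ^ 2) *
            (ENNReal.ofReal (m ^ (-(4 * H))) * D)) := by gcongr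
      _ = W := by
          have : m ^ (1 - 4 * H) = m * m ^ (-(4 * H)) := by
            rw [sub_eq_add_neg, Real.rpow_add hm, Real.rpow_one]
          simp only [W]
          rw [this, ENNReal.ofReal_mul hm.le]
          ring
  have hsq : Real.sqrt 2 ^ 2 = 2 := Real.sq_sqrt (by norm_num)
  have hpi : 1 ≤ Real.pi ^ 2 := one_le_pow₀ (by linarith [Real.pi_gt_three])
  have h1 : ∀ s, ∫⁻ ω, ‖sinePoly I (fun k => y k ω) s‖ₑ ^ (n + 1) ∂P ≤ gaussMoment r * W ^ r := by
    intro s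
    refine le_trans (le_of_eq ?_) (hmom (fun k => Real.sqrt 2 * Real.sin ((k + 1 : ℕ) * Real.pi * s))
      fun k _ => ?_)
    · simp only [sinePoly, mul_comm]
    · rw [mul_pow, hsq]
      nlinarith [Real.sin_sq_le_one ((k + 1 : ℕ) * Real.pi * s)]
  have h2 : ∀ s, ∫⁻ ω, ‖sinePolyDeriv I (fun k => y k ω) s / m‖ₑ ^ (n + 1) ∂P ≤
      gaussMoment r * W ^ r := by
    intro s
    refine le_trans (le_of_eq ?_) (hmom (fun k => Real.sqrt 2 *
      (Real.cos ((k + 1 : ℕ) * Real.pi * s) * ((k + 1 : ℕ) * Real.pi)) / m) fun k hk => ?_)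
    · simp only [sinePolyDeriv, Finset.sum_div]
      congr! 5 with ω k
      ring
    · have hk1 : ((k + 1 : ℕ) : ℝ) / m ≤ 2 := by
        rw [div_le_iff₀ hm]
        exact_mod_cast (hI k hk).2
      have e : (Real.sqrt 2 * (Real.cos ((k + 1 : ℕ) * Real.pi * s) * ((k + 1 : ℕ) * Real.pi)) / m) ^ 2
          = Real.sqrt 2 ^ 2 * Real.pi ^ 2 * (Real.cos ((k + 1 : ℕ) * Real.pi * s) ^ 2 *
            (((k + 1 : ℕ) : ℝ) / m) ^ 2) := by ring
      have h4 : (((k + 1 : ℕ) : ℝ) / m) ^ 2 ≤ 4 := by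
        have : (0 : ℝ) ≤ ((k + 1 : ℕ) : ℝ) / m := by positivity
        nlinarith
      have h5 : Real.cos ((k + 1 : ℕ) * Real.pi * s) ^ 2 * (((k + 1 : ℕ) : ℝ) / m) ^ 2 ≤ 1 * 4 :=
        mul_le_mul (Real.cos_sq_le_one _) h4 (by positivity) zero_le_one
      rw [e, hsq]
      nlinarith
  have hmeas := aemeasurable_blockBound_integrand (P := P) I
    (fun k => (hy k).aestronglyMeasurable.aemeasurable) m n
  have hmeas1 : ∀ s, AEMeasurable (fun ω => ‖sinePoly I (fun k => y k ω) s‖ₑ ^ (n + 1)) P := by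
    intro s
    unfold sinePoly
    exact (Finset.aemeasurable_fun_sum _ fun k _ =>
      (hy k).aestronglyMeasurable.aemeasurable.mul_const _).enorm.pow_const _
  unfold blockBound
  rw [lintegral_const_mul' _ _ ENNReal.ofReal_ne_top, lintegral_lintegral_swap hmeas]
  calc ENNReal.ofReal ((n + 1) * m) * ∫⁻ s, ∫⁻ ω, (‖sinePoly I (fun k => y k ω) s‖ₑ ^ (n + 1) +
          ‖sinePolyDeriv I (fun k => y k ω) s / m‖ₑ ^ (n + 1)) ∂P ∂domMeasure
      ≤ ENNReal.ofReal ((n + 1) * m) * ∫⁻ _, (2 * (gaussMoment r * W ^ r)) ∂domMeasure := by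
        gcongr with s
        rw [lintegral_add_left' (hmeas1 s), two_mul]
        exact add_le_add (h1 s) (h2 s)
    _ = ENNReal.ofReal ((n + 1) * m) * (2 * (gaussMoment r * W ^ r)) := by
        rw [lintegral_const]
        simp
    _ = _ := by
        have e1 : ((n : ℝ) + 1) = 2 * r := by exact_mod_cast hn
        have e2 : m ^ (1 + (1 - 4 * H) * r) = m * (m ^ (1 - 4 * H)) ^ r := by
          rw [Real.rpow_add hm, Real.rpow_one, Real.rpow_mul hm.le, Real.rpow_natCast]
        rw [e1, e2, ENNReal.ofReal_mul (by positivity), ENNReal.ofReal_mul hm.le,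
          ENNReal.ofReal_pow (by positivity)]
        simp only [W, blockConst, D]
        ring

end Block

/-! ### The stochastic convolutions as series of modes -/

section Convolution

variable {Ω : Type*} [MeasurableSpace Ω] {P : Measure Ω} {H T t : ℝ} {w : ℕ → ℝ → Ω → ℝ}

/-- The partial sums `∑_{k < n} y_k φ_{k + 1}`. -/
noncomputable def modeSum (y : ℕ → Ω → ℝ) (n : ℕ) (ω : Ω) : U :=
  ∑ k ∈ Finset.range n, y k ω • eigenfun (k + 1)

theorem memLp_smul_const {y : Ω → ℝ} (hy : MemLp y 2 P) (u : U) :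
    MemLp (fun ω => y ω • u) 2 P :=
  (ContinuousLinearMap.toSpanSingleton ℝ u).comp_memLp' hy

theorem memLp_modeSum {y : ℕ → Ω → ℝ} (hy : ∀ k, MemLp (y k) 2 P) (n : ℕ) :
    MemLp (modeSum y n) 2 P :=
  memLp_finsetSum _ fun k _ => memLp_smul_const (hy k) _

omit [MeasurableSpace Ω] in
theorem modeSum_sub_modeSum (y : ℕ → Ω → ℝ) {n m : ℕ} (h : n ≤ m) (ω : Ω) :
    modeSum y m ω - modeSum y n ω = ∑ k ∈ Finset.Ico n m, y k ω • eigenfun (k + 1) :=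
  (Finset.sum_Ico_eq_sub _ h).symm

omit [MeasurableSpace Ω] in
theorem galerkinProj_modeSum (y : ℕ → Ω → ℝ) {N n : ℕ} (h : N ≤ n) (ω : Ω) :
    galerkinProj N (modeSum y n ω) = modeSum y N ω := by
  unfold modeSum
  simp_rw [map_sum, map_smul, galerkinProj_eigenfun, smul_ite, smul_zero]
  rw [← Finset.sum_filter]
  congr 1
  ext k
  simp only [Finset.mem_filter, Finset.mem_range]
  omega

/-- Mean square convergence of the series `∑ y_k φ_{k + 1}`. -/
theorem exists_tendsto_modeSum {y : ℕ → Ω → ℝ} (hy : ∀ k, MemLp (y k) 2 P)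
    (hsum : ∑' k, ∫⁻ ω, ‖y k ω‖ₑ ^ 2 ∂P ≠ ∞) :
    ∃ O : Ω → U, MemLp O 2 P ∧
      Tendsto (fun n => ∫⁻ ω, ‖O ω - modeSum y n ω‖ₑ ^ 2 ∂P) atTop (𝓝 0) := by
  set v : ℕ → ℝ≥0∞ := fun k => ∫⁻ ω, ‖y k ω‖ₑ ^ 2 ∂P
  have hle : ∀ n m, n ≤ m →
      ∫⁻ ω, ‖modeSum y m ω - modeSum y n ω‖ₑ ^ 2 ∂P ≤ ∑' k, v (k + n) := by
    intro n m h
    simp_rw [modeSum_sub_modeSum y h, enorm_sum_smul_eigenfun_sq]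
    rw [lintegral_finsetSum' _ fun k _ => (hy k).aestronglyMeasurable.enorm.pow_const 2,
      Finset.sum_Ico_eq_sum_range]
    simp_rw [add_comm n]
    exact ENNReal.sum_le_tsum (f := fun k => v (k + n)) _
  refine exists_tendsto_lintegral_enorm_sub_sq (memLp_modeSum hy)
    (ENNReal.tendsto_sum_nat_add v hsum) fun n m => ?_
  rcases le_total n m with h | h
  · rw [lintegral_enorm_sub_sq_comm]
    exact (hle n m h).trans le_self_add
  · exact (hle m n h).trans le_add_self

/-- `y_k` is the integral `∫₀ᵗ e^{-λ_{k + 1}(t - s)} dw_k(s)`, the `k`-th mode of the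
stochastic convolution. -/
structure IsModes (P : Measure Ω) (H : ℝ) (w : ℕ → ℝ → Ω → ℝ) (ht : 0 ≤ t) (y : ℕ → Ω → ℝ) :
    Prop where
  memLp : ∀ k, MemLp (y k) 2 P
  tendsto : ∀ k, Tendsto (fun n => ∫⁻ ω, ‖y k ω -
    (expStep (eigenval (k + 1)) ht n).integral (w k) ω‖ₑ ^ 2 ∂P) atTop (𝓝 0)

theorem IsCylindricalFBm.exists_isModes (hH : H ∈ Set.Ioo (1 / 2 : ℝ) 1)
    (hw : IsCylindricalFBm H T w P) (ht : 0 ≤ t) (htT : t ≤ T) :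
    ∃ y : ℕ → Ω → ℝ, IsModes P H w ht y := by
  choose y h1 h2 using fun k => exists_integral_exp hH (hw.isFBm k) ht htT (eigenval_pos k)
  exact ⟨y, h1, h2⟩

namespace IsModes

variable {ht : 0 ≤ t} {y : ℕ → Ω → ℝ}

theorem tsum_ne_top (hy : IsModes P H w ht y) (hH : H ∈ Set.Ioo (1 / 2 : ℝ) 1)
    (hw : IsCylindricalFBm H T w P) (htT : t ≤ T) :
    ∑' k, ∫⁻ ω, ‖y k ω‖ₑ ^ 2 ∂P ≠ ∞ := by
  have h : ∑' k : ℕ, 2 * (ENNReal.ofReal (eigenval (k + 1) ^ (-(2 * H))) * expEnergy H) ≠ ∞ := by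
    rw [ENNReal.tsum_mul_left, ENNReal.tsum_mul_right]
    exact ENNReal.mul_ne_top ENNReal.ofNat_ne_top
      (ENNReal.mul_ne_top (tsum_eigenval_rpow_ne_top hH.1) (expEnergy_lt_top hH).ne)
  exact ne_top_of_le_ne_top h (ENNReal.tsum_le_tsum fun k =>
    lintegral_integral_exp_sq_le hH (hw.isFBm k) ht htT (eigenval_pos k) (hy.memLp k) (hy.tendsto k))

theorem isFBmIntegral_smul (hy : IsModes P H w ht y) (hH : H ∈ Set.Ioo (1 / 2 : ℝ) 1) (k : ℕ)
    (u : U) : IsFBmIntegral P H t (w k) (fun s => Real.exp (-eigenval (k + 1) * (t - s)) • u)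
      (fun ω => y k ω • u) :=
  isFBmIntegral_exp_smul hH ht (eigenval_pos k) (hy.memLp k) (hy.tendsto k) u

theorem isFBmIntegral_semigroup (hy : IsModes P H w ht y) (hH : H ∈ Set.Ioo (1 / 2 : ℝ) 1)
    (k : ℕ) : IsFBmIntegral P H t (w k) (fun s => semigroup (t - s) (eigenfun (k + 1)))
      (fun ω => y k ω • eigenfun (k + 1)) := by
  simp_rw [semigroup_eigenfun]
  exact hy.isFBmIntegral_smul hH k _

theorem isFBmIntegral_galerkinSemigroup (hy : IsModes P H w ht y)
    (hH : H ∈ Set.Ioo (1 / 2 : ℝ) 1) (N k : ℕ) :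
    IsFBmIntegral P H t (w k)
      (fun s => galerkinSemigroup N (t - s) (galerkinProj N (eigenfun (k + 1))))
      (fun ω => y k ω • if k < N then eigenfun (k + 1) else 0) := by
  simp_rw [galerkinSemigroup_galerkinProj_eigenfun]
  exact hy.isFBmIntegral_smul hH k _

omit [MeasurableSpace Ω] in
theorem sum_smul_ite (y : ℕ → Ω → ℝ) {N n : ℕ} (h : N ≤ n) (ω : Ω) :
    ∑ k ∈ Finset.range n, y k ω • (if k < N then eigenfun (k + 1) else 0) = modeSum y N ω := by
  rw [← galerkinProj_modeSum y h]
  simp_rw [modeSum, map_sum, map_smul, galerkinProj_eigenfun]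

/-- The stochastic convolution is the mean square sum of its modes. -/
theorem isStochConv_iff (hy : IsModes P H w ht y) (hH : H ∈ Set.Ioo (1 / 2 : ℝ) 1)
    (hw : IsCylindricalFBm H T w P) (htT : t ≤ T) {O : Ω → U} :
    IsStochConv P H t w O ↔ MemLp O 2 P ∧
      Tendsto (fun n => ∫⁻ ω, ‖O ω - modeSum y n ω‖ₑ ^ 2 ∂P) atTop (𝓝 0) := by
  constructor
  · rintro ⟨hO, Y, hY, hlim⟩
    refine ⟨hO, hlim.congr fun n => lintegral_congr_ae ?_⟩
    have h : ∀ᵐ ω ∂P, ∀ k, Y k ω = y k ω • eigenfun (k + 1) := by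
      rw [ae_all_iff]
      exact fun k => IsFBmIntegral.ae_eq hH (hw.isFBm k) htT (hY k) (hy.isFBmIntegral_semigroup hH k)
    filter_upwards [h] with ω hω
    simp only [hω, modeSum]
  · rintro ⟨hO, hlim⟩
    exact ⟨hO, _, hy.isFBmIntegral_semigroup hH, hlim⟩

/-- The Galerkin approximation of the stochastic convolution is the sum of its first modes. -/
theorem isGalerkinStochConv_modeSum (hy : IsModes P H w ht y) (hH : H ∈ Set.Ioo (1 / 2 : ℝ) 1)
    (N : ℕ) : IsGalerkinStochConv P H t w N (modeSum y N) := by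
  refine ⟨memLp_modeSum hy.memLp N, _, hy.isFBmIntegral_galerkinSemigroup hH N, ?_⟩
  refine tendsto_const_nhds.congr' ?_
  filter_upwards [eventually_ge_atTop N] with n hn
  simp_rw [sum_smul_ite y hn]
  simp

theorem ae_eq_modeSum (hy : IsModes P H w ht y) (hH : H ∈ Set.Ioo (1 / 2 : ℝ) 1)
    (hw : IsCylindricalFBm H T w P) (htT : t ≤ T) {N : ℕ} {ON : Ω → U}
    (hON : IsGalerkinStochConv P H t w N ON) : ON =ᵐ[P] modeSum y N := by
  obtain ⟨hm, Y, hY, hlim⟩ := hON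
  have h : ∀ᵐ ω ∂P, ∀ k, Y k ω = y k ω • if k < N then eigenfun (k + 1) else 0 := by
    rw [ae_all_iff]
    exact fun k => IsFBmIntegral.ae_eq hH (hw.isFBm k) htT (hY k)
      (hy.isFBmIntegral_galerkinSemigroup hH N k)
  -- Modes beyond `N` contribute zero, so the partial sums are constant for `n ≥ N`; a constant mean
  -- square distance that tends to zero is zero.
  refine ae_eq_of_lintegral_enorm_sub_sq_eq_zero hm.aestronglyMeasurable
    (memLp_modeSum hy.memLp N).aestronglyMeasurable (tendsto_nhds_unique ?_ hlim)
  refine tendsto_const_nhds.congr' ?_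
  filter_upwards [eventually_ge_atTop N] with n hn
  refine lintegral_congr_ae ?_
  filter_upwards [h] with ω hω
  rw [Finset.sum_congr rfl fun k _ => hω k, sum_smul_ite y hn]

/-- The Galerkin projection of the stochastic convolution is the sum of its first modes. -/
theorem galerkinProj_ae_eq (hy : IsModes P H w ht y) {O : Ω → U} (hO : MemLp O 2 P)
    (hlim : Tendsto (fun n => ∫⁻ ω, ‖O ω - modeSum y n ω‖ₑ ^ 2 ∂P) atTop (𝓝 0)) (N : ℕ) :
    (fun ω => galerkinProj N (O ω)) =ᵐ[P] modeSum y N := by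
  refine ae_eq_of_lintegral_enorm_sub_sq_eq_zero
    ((galerkinProj N).continuous.comp_aestronglyMeasurable hO.aestronglyMeasurable)
    (memLp_modeSum hy.memLp N).aestronglyMeasurable (le_antisymm ?_ zero_le)
  -- For `n ≥ N` the projection sends the partial sum to `modeSum y N`, and it is a contraction, so
  -- the difference is bounded by the error at stage `n`.
  refine ge_of_tendsto hlim ?_
  filter_upwards [eventually_ge_atTop N] with n hn
  refine lintegral_mono fun ω => ?_
  rw [← galerkinProj_modeSum y hn, ← map_sub]
  gcongr
  rw [enorm_le_iff_norm_le]
  exact Submodule.norm_starProjection_apply_le _ _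

end IsModes

/-! ### Dyadic decomposition of the tail -/

/-- The indices of the modes `2^j(N + 1), …, 2^{j+1}(N + 1) - 1`. -/
def dyadicBlock (N j : ℕ) : Finset ℕ := Finset.Ico (2 ^ j * (N + 1) - 1) (2 ^ (j + 1) * (N + 1) - 1)

/-- The partial sums at the dyadic ends telescope into blocks and converge almost surely in `U`
along a subsequence. Lower semicontinuity of the sup norm carries the triangle inequality over to
the limit. -/
theorem supNorm_sub_modeSum_le {y : ℕ → Ω → ℝ} (hy : ∀ k, MemLp (y k) 2 P) {O : Ω → U}
    (hO : MemLp O 2 P)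
    (hlim : Tendsto (fun n => ∫⁻ ω, ‖O ω - modeSum y n ω‖ₑ ^ 2 ∂P) atTop (𝓝 0)) (N n : ℕ) :
    ∀ᵐ ω ∂P, supNorm (O ω - modeSum y N ω) ≤
      ∑' j : ℕ, blockBound (dyadicBlock N j) y (2 ^ j * (N + 1)) n ω ^ (1 / ((n : ℝ) + 1)) := by
  -- The shift by one converts mode numbers into indices, so that the zeroth end is exactly `N`.
  set e : ℕ → ℕ := fun j => 2 ^ j * (N + 1) - 1 with he
  have he0 : e 0 = N := by simp [he]
  have hle : ∀ j, j ≤ e j := fun j => by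
    have h1 : j < 2 ^ j := Nat.lt_two_pow_self
    have h2 : 2 ^ j * 1 ≤ 2 ^ j * (N + 1) := Nat.mul_le_mul_left _ (by omega)
    simp only [he]
    omega
  have hmono : ∀ j, e j ≤ e (j + 1) := fun j => by
    have : 2 ^ j * (N + 1) ≤ 2 ^ (j + 1) * (N + 1) :=
      Nat.mul_le_mul_right _ (Nat.pow_le_pow_right (by norm_num) (by omega))
    simp only [he]
    omega
  have hetop : Tendsto e atTop atTop := tendsto_atTop_mono hle tendsto_id
  obtain ⟨ns, -, hns⟩ := exists_seq_tendsto_ae_of_tendsto_lintegral_enorm_sub_sq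
    hO.aestronglyMeasurable (fun j => (memLp_modeSum hy (e j)).aestronglyMeasurable)
    (hlim.comp hetop)
  filter_upwards [hns] with ω hω
  refine supNorm_le_of_tendsto (hω.sub_const (modeSum y N ω)) fun i => ?_
  have h1 : modeSum y (e (ns i)) ω - modeSum y N ω = ∑ j ∈ Finset.range (ns i),
      ∑ k ∈ dyadicBlock N j, y k ω • eigenfun (k + 1) := by
    have h2 := Finset.sum_range_sub (fun j => modeSum y (e j) ω) (ns i)
    rw [he0] at h2
    rw [← h2]
    exact Finset.sum_congr rfl fun j _ => modeSum_sub_modeSum y (hmono j) ω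
  rw [h1]
  refine (supNorm_sum_le _ _).trans (le_trans (Finset.sum_le_sum fun j _ => ?_)
    (ENNReal.sum_le_tsum _))
  have h2 := supNorm_sum_pow_le (dyadicBlock N j) (fun k => y k ω)
    (M := 2 ^ j * ((N : ℝ) + 1)) (by positivity) n
  rw [one_div, ENNReal.le_rpow_inv_iff (by positivity)]
  refine le_trans (le_of_eq ?_) h2
  rw [← ENNReal.rpow_natCast]
  push_cast
  rfl

theorem lintegral_dyadicBlock_le [IsProbabilityMeasure P] (hH : H ∈ Set.Ioo (1 / 2 : ℝ) 1)
    (hw : IsCylindricalFBm H T w P) {ht : 0 ≤ t} (htT : t ≤ T) {y : ℕ → Ω → ℝ}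
    (hy : IsModes P H w ht y) (N j : ℕ) {n r : ℕ} (hn : n + 1 = 2 * r) :
    ∫⁻ ω, blockBound (dyadicBlock N j) y (2 ^ j * (N + 1)) n ω ∂P ≤
      blockConst H r * ENNReal.ofReal ((2 ^ j * ((N : ℝ) + 1)) ^ (1 + (1 - 4 * H) * r)) := by
  have h1 : 1 ≤ 2 ^ j * (N + 1) := Nat.one_le_iff_ne_zero.2 (by positivity)
  have h2 : 2 ^ (j + 1) * (N + 1) = 2 * (2 ^ j * (N + 1)) := by ring
  refine lintegral_blockBound_le hH hw ht htT hy.memLp hy.tendsto (by positivity) (fun k hk => ?_)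
    ?_ hn
  · rw [dyadicBlock, Finset.mem_Ico, h2] at hk
    constructor
    · have : 2 ^ j * (N + 1) ≤ k + 1 := by omega
      exact_mod_cast this
    · have : k + 1 ≤ 2 * (2 ^ j * (N + 1)) := by omega
      exact_mod_cast this
  · have : (dyadicBlock N j).card ≤ 2 ^ j * (N + 1) := by
      rw [dyadicBlock, Nat.card_Ico, h2]
      omega
    exact_mod_cast this

/-- The constant in the moment bound for the tail of the series. -/
noncomputable def tailConst (H : ℝ) (r : ℕ) : ℝ≥0∞ :=
  blockConst H r ^ (1 / (2 * r : ℝ)) *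
    (1 - ENNReal.ofReal (2 ^ (1 / (2 * r) + 1 / 2 - 2 * H : ℝ)))⁻¹

/-- The geometric ratio is below one: for `r ≥ 1` its exponent is at most `1 - 2H`, which is
negative. -/
theorem tailConst_lt_top (hH : H ∈ Set.Ioo (1 / 2 : ℝ) 1) {r : ℕ} (hr : 1 ≤ r) :
    tailConst H r < ∞ := by
  unfold tailConst
  have hr' : (1 : ℝ) ≤ r := by exact_mod_cast hr
  refine ENNReal.mul_lt_top (ENNReal.rpow_lt_top_of_nonneg (by positivity) (blockConst_lt_top hH r).ne)
    (ENNReal.inv_lt_top.2 (tsub_pos_of_lt ?_))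
  rw [ENNReal.ofReal_lt_one]
  refine Real.rpow_lt_one_of_one_lt_of_neg one_lt_two ?_
  have : 1 / (2 * (r : ℝ)) ≤ 1 / 2 := by
    rw [div_le_div_iff₀ (by positivity) (by norm_num)]
    linarith
  linarith [hH.1]

/-- On a probability space the moment of order `p` is controlled by that of order `2r`. Minkowski's
inequality then sums the `L^{2r}` norms of the blocks, a geometric series of ratio `2^γ` starting at
`(N + 1)^γ`. -/
theorem lintegral_supNorm_sub_modeSum_le [IsProbabilityMeasure P]
    (hH : H ∈ Set.Ioo (1 / 2 : ℝ) 1) (hw : IsCylindricalFBm H T w P) {ht : 0 ≤ t} (htT : t ≤ T)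
    {y : ℕ → Ω → ℝ} (hy : IsModes P H w ht y) {O : Ω → U} (hO : MemLp O 2 P)
    (hlim : Tendsto (fun n => ∫⁻ ω, ‖O ω - modeSum y n ω‖ₑ ^ 2 ∂P) atTop (𝓝 0)) (N : ℕ)
    {p : ℝ} (hp : 0 < p) {r : ℕ} (hr : 1 ≤ r) (hpr : p ≤ 2 * r) :
    (∫⁻ ω, supNorm (O ω - modeSum y N ω) ^ p ∂P) ^ (1 / p) ≤
      tailConst H r * ENNReal.ofReal (((N : ℝ) + 1) ^ (1 / (2 * r) + 1 / 2 - 2 * H)) := by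
  obtain ⟨n, hn⟩ : ∃ n, n + 1 = 2 * r := ⟨2 * r - 1, by omega⟩
  have hnr : (n : ℝ) + 1 = 2 * r := by exact_mod_cast hn
  have hr' : (1 : ℝ) ≤ r := by exact_mod_cast hr
  set q : ℝ := 2 * r with hq
  set γ : ℝ := 1 / q + 1 / 2 - 2 * H with hγ
  have hq0 : 0 < q := by positivity
  set G : ℕ → Ω → ℝ≥0∞ := fun j ω =>
    blockBound (dyadicBlock N j) y (2 ^ j * (N + 1)) n ω ^ (1 / q)
  have hGm : ∀ j, AEMeasurable (G j) P := fun j => (aemeasurable_blockBound _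
    (fun k => (hy.memLp k).aestronglyMeasurable.aemeasurable) _ _).pow_const _
  have hG : ∀ j, (∫⁻ ω, G j ω ^ q ∂P) ^ (1 / q) ≤ blockConst H r ^ (1 / q) *
      ENNReal.ofReal (((N : ℝ) + 1) ^ γ) * ENNReal.ofReal (2 ^ γ) ^ j := by
    intro j
    have e1 : ∀ ω, G j ω ^ q = blockBound (dyadicBlock N j) y (2 ^ j * (N + 1)) n ω := by
      intro ω
      simp only [G]
      rw [← ENNReal.rpow_mul, one_div_mul_cancel hq0.ne', ENNReal.rpow_one]
    simp_rw [e1]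
    calc _ ≤ (blockConst H r *
          ENNReal.ofReal ((2 ^ j * ((N : ℝ) + 1)) ^ (1 + (1 - 4 * H) * r))) ^ (1 / q) := by
          gcongr
          exact lintegral_dyadicBlock_le hH hw htT hy N j hn
      _ = _ := by
          have h2 : (0 : ℝ) ≤ 2 ^ j * ((N : ℝ) + 1) := by positivity
          -- Taking the root of order `2r` of the block moment turns its exponent into `γ`.
          have e2 : (1 + (1 - 4 * H) * r) * (1 / q) = γ := by
            rw [hγ, hq]
            field_simp
            ring
          rw [ENNReal.mul_rpow_of_nonneg _ _ (by positivity),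
            ENNReal.ofReal_rpow_of_nonneg (by positivity) (by positivity),
            ← Real.rpow_mul h2, e2, Real.mul_rpow (by positivity) (by positivity),
            ENNReal.ofReal_mul (by positivity), ← ENNReal.ofReal_pow (by positivity),
            ← Real.rpow_natCast, ← Real.rpow_natCast, ← Real.rpow_mul (by norm_num),
            ← Real.rpow_mul (by norm_num), mul_comm γ]
          ring
  calc (∫⁻ ω, supNorm (O ω - modeSum y N ω) ^ p ∂P) ^ (1 / p)
      ≤ (∫⁻ ω, (∑' j, G j ω) ^ p ∂P) ^ (1 / p) := by
        gcongr ?_ ^ _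
        refine lintegral_mono_ae ?_
        filter_upwards [supNorm_sub_modeSum_le hy.memLp hO hlim N n] with ω hω
        rw [hnr] at hω
        gcongr
    _ ≤ (∫⁻ ω, (∑' j, G j ω) ^ q ∂P) ^ (1 / q) :=
        lintegral_rpow_one_div_mono (AEMeasurable.tsum hGm) hp hpr
    _ ≤ ∑' j, (∫⁻ ω, G j ω ^ q ∂P) ^ (1 / q) :=
        lintegral_tsum_rpow_le hGm (by linarith)
    _ ≤ ∑' j, blockConst H r ^ (1 / q) * ENNReal.ofReal (((N : ℝ) + 1) ^ γ) *
          ENNReal.ofReal (2 ^ γ) ^ j := ENNReal.tsum_le_tsum hG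
    _ = _ := by
        rw [ENNReal.tsum_mul_left, ENNReal.tsum_geometric, tailConst]
        ring

end Convolution

/-! ### From powers of the mode number to eigenvalues, and the conclusion -/

theorem rpow_le_eigenval_rpow {β H s : ℝ} (hs : s ≤ 2 * (β - H + 1 / 4)) (N : ℕ) :
    ((N : ℝ) + 1) ^ s ≤
      Real.pi ^ (-(2 * (β - H + 1 / 4))) * eigenval (N + 1) ^ (β - H + 1 / 4) := by
  have hN : (0 : ℝ) < (N : ℝ) + 1 := by positivity
  have hpi := Real.pi_pos
  have e : eigenval (N + 1) ^ (β - H + 1 / 4) =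
      ((N : ℝ) + 1) ^ (2 * (β - H + 1 / 4)) * Real.pi ^ (2 * (β - H + 1 / 4)) := by
    unfold eigenval
    push_cast
    rw [Real.mul_rpow (by positivity) (by positivity), ← Real.rpow_natCast, ← Real.rpow_natCast,
      ← Real.rpow_mul hN.le, ← Real.rpow_mul hpi.le]
    norm_num
  rw [e, mul_left_comm, ← Real.rpow_add hpi, neg_add_cancel, Real.rpow_zero, mul_one]
  exact Real.rpow_le_rpow_of_exponent_le (by linarith [(Nat.cast_nonneg N : (0 : ℝ) ≤ N)]) hs

end FBmGalerkin

open FBmGalerkin in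
theorem mainTheorem6 (p β H : ℝ) (hp : 2 ≤ p) (hβ : β ∈ Set.Ioo (0 : ℝ) (1 / 4))
    (hH : H ∈ Set.Ioo (1 / 2 : ℝ) 1) :
    ∃ C : ℝ, 0 < C ∧
      ∀ (Ω : Type*) [MeasurableSpace Ω] (P : Measure Ω) [IsProbabilityMeasure P]
        (T : ℝ) (w : ℕ → ℝ → Ω → ℝ), IsCylindricalFBm H T w P →
      ∀ t ∈ Set.Icc 0 T, ∀ N : ℕ,
        (∃ O : Ω → U, IsStochConv P H t w O) ∧
        (∃ ON : Ω → U, IsGalerkinStochConv P H t w N ON) ∧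
        ∀ O ON : Ω → U, IsStochConv P H t w O → IsGalerkinStochConv P H t w N ON →
          (∀ᵐ ω ∂P, ON ω = galerkinProj N (O ω)) ∧
          (∫⁻ ω, supNorm (O ω - ON ω) ^ p ∂P) ^ (1 / p) ≤
            ENNReal.ofReal (C * eigenval (N + 1) ^ (β - H + 1 / 4)) := by
  -- The bound `p ≤ r` makes the moment of order `2r` dominate that of order `p`, and `1/(4β) ≤ r`
  -- makes the loss `1/(2r)` at most `2β`. The choice involves only `p` and `β`.
  obtain ⟨r, hr⟩ := exists_nat_ge (max p (1 / (4 * β)))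
  have hβ0 : 0 < β := hβ.1
  have hrp : p ≤ r := (le_max_left _ _).trans hr
  have hrβ : 1 / (4 * β) ≤ r := (le_max_right _ _).trans hr
  have hr0 : (0 : ℝ) < r := by linarith
  have hr1 : 1 ≤ r := by exact_mod_cast hr0
  have hs : 1 / (2 * (r : ℝ)) + 1 / 2 - 2 * H ≤ 2 * (β - H + 1 / 4) := by
    have : 1 / (2 * (r : ℝ)) ≤ 2 * β := by
      rw [div_le_iff₀ (by positivity)] at hrβ ⊢
      linarith
    linarith
  have hK := tailConst_lt_top hH hr1
  set K := tailConst H r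
  have hpi : 0 < Real.pi ^ (-(2 * (β - H + 1 / 4))) := Real.rpow_pos_of_pos Real.pi_pos _
  -- Adding `1` makes positivity of the constant immediate; the power of `π` compensates for the one
  -- contained in the eigenvalue.
  refine ⟨(K.toReal + 1) * Real.pi ^ (-(2 * (β - H + 1 / 4))), by positivity, ?_⟩
  intro Ω _ P _ T w hw t ht N
  obtain ⟨y, hy⟩ := hw.exists_isModes hH ht.1 ht.2
  refine ⟨?_, ⟨_, hy.isGalerkinStochConv_modeSum hH N⟩, fun O ON hO hON => ?_⟩
  · obtain ⟨O, hO, hlim⟩ := exists_tendsto_modeSum hy.memLp (hy.tsum_ne_top hH hw ht.2)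
    exact ⟨O, (hy.isStochConv_iff hH hw ht.2).2 ⟨hO, hlim⟩⟩
  · obtain ⟨hOm, hlim⟩ := (hy.isStochConv_iff hH hw ht.2).1 hO
    have h1 := hy.ae_eq_modeSum hH hw ht.2 hON
    refine ⟨?_, ?_⟩
    · filter_upwards [h1, hy.galerkinProj_ae_eq hOm hlim N] with ω e1 e2
      rw [e1, e2]
    · have e : ∫⁻ ω, supNorm (O ω - ON ω) ^ p ∂P = ∫⁻ ω, supNorm (O ω - modeSum y N ω) ^ p ∂P := by
        refine lintegral_congr_ae ?_
        filter_upwards [h1] with ω e1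
        rw [e1]
      rw [e]
      refine (lintegral_supNorm_sub_modeSum_le hH hw ht.2 hy hOm hlim N (by linarith) hr1
        (by linarith)).trans ?_
      rw [mul_assoc, ENNReal.ofReal_mul (by positivity)]
      gcongr
      · exact (ENNReal.ofReal_toReal hK.ne).symm.le.trans (ENNReal.ofReal_le_ofReal (by linarith))
      · exact rpow_le_eigenval_rpow hs N
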